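/- **Conventions.** An $L\times L$ matrix-valued differential form is a matrix $\omega=(\omega^{(ij)})$ of real differential forms; it is of class $C^0$ if the coefficients of its entries are continuous in every $C^2$ chart. Pullback, exterior derivative and integration act entrywise, and $(\lambda\wedge\mu)^{(ij)}=\sum_{q=1}^{L}\lambda^{(iq)}\wedge\mu^{(qj)}$, with the wedge product normalized so that $(\alpha\wedge\beta)(v,w)=\alpha(v)\beta(w)-\alpha(w)\beta(v)$ for real $1$-forms. Let $\mathcal M$ be an $M$-dimensional $C^2$ manifold. A $C^0$ matrix-valued $2$-form $\delta\phi$ on $\mathcal M$ is called the *distributional exterior derivative* of a $C^0$ matrix-valued $1$-form $\phi$ on $\mathcal M$ if, for every $C^2$ chart $(\mathcal W,\Phi)$ and every matrix-valued $(M-2)$-form $\psi$ of class $C^2$ with compact support in $\Phi(\mathcal W)\subset\mathbb R^M$, $$\int_{\Phi(\mathcal W)}(\Phi^{-1})^*\phi\wedge d\psi=\int_{\Phi(\mathcal W)}(\Phi^{-1})^*(\delta\phi)\wedge\psi .$$ (If $M\le 1$ there are no such $\psi$, the condition is empty, and $\delta\phi=0$ for reasons of degree.) For $m\ge M$, a point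 $Q\in\mathcal M$ is an *$m$-density point* of $A\subset\mathcal M$ if there is a $C^1$ chart $(\mathcal W,\Phi)$ with $Q\in\mathcal W$ and $$\mathcal L^M\big(B_r(\Phi(Q))\setminus\Phi(A\cap\mathcal W)\big)=o(r^m)\qquad(r\to0+),$$ where $\mathcal L^M$ is Lebesgue (outer) measure. The set of these points is denoted by $A^{(m)}$. Let $G$ be a Lie subgroup of $\mathrm{Gl}(L,\mathbb R)$, that is, a Lie group with an injective homomorphism $\iota:G\to\mathrm{Gl}(L,\mathbb R)$ that is a smooth immersion (the inclusion). Its Maurer–Cartan form is the matrix-valued $1$-form $\Gamma_G=\iota^*(z^{-1}\,dz)$, where $z=(z_{ij})$ are the coordinates of $\mathbb R^{L\times L}\supset\mathrm{Gl}(L,\mathbb R)$ and $dz=(dz_{ij})$. **Theorem.** Let $\mathcal M$ be an $M$-dimensional $C^2$ manifold, let $\phi$ be an $L\times L$ matrix-valued $C^0$ differential $1$-form on $\mathcal M$ that has a distributional exterior derivative $\delta\phi$ of class $C^0$, let $\mathcal U\subset\mathcal M$ be open, and let $f:\mathcal U\to G$ be a $C^1$ map. Then $$(\delta\phi)_Q=-(\phi\wedge\phi)_Q\qquad\text{for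 all }Q\in\mathcal U\cap\{P\in\mathcal U\mid (f^*\Gamma_G)_P=\phi_P\}^{(M+1)} .$$ -/

import Mathlib

open Set Filter Topology MeasureTheory
open scoped Manifold ContDiff

noncomputable section

/-- The Euclidean space `ℝ^M`. -/
abbrev Euc (M : ℕ) : Type := EuclideanSpace ℝ (Fin M)

section Wedge

variable {V : Type*} [AddCommGroup V] [Module ℝ V] [TopologicalSpace V]

/-- The tensor product of two alternating maps: the continuous multilinear map
`(v₁, …, v_{p+q}) ↦ a (v₁, …, v_p) * b (v_{p+1}, …, v_{p+q})`. -/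
def tensorForm {p q : ℕ} (a : V [⋀^Fin p]→L[ℝ] ℝ) (b : V [⋀^Fin q]→L[ℝ] ℝ) :
    ContinuousMultilinearMap ℝ (fun _ : Fin (p + q) => V) ℝ where
  toMultilinearMap :=
    ((LinearMap.mul' ℝ ℝ).compMultilinearMap
      (MultilinearMap.domCoprod a.toMultilinearMap b.toMultilinearMap)).domDomCongr finSumFinEquiv
  cont := by
    change Continuous fun v : Fin (p + q) → V =>
      a (fun i => v (finSumFinEquiv (Sum.inl i))) * b (fun i => v (finSumFinEquiv (Sum.inr i)))
    exact (a.cont.comp (by fun_prop)).mul (b.cont.comp (by fun_prop))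

/-- The exterior product of two alternating forms, in the determinant normalization:
`(a ∧ b)(v) = 1 / (p! q!) ∑_σ sgn(σ) a (v_{σ 1}, …, v_{σ p}) b (v_{σ (p+1)}, …, v_{σ (p+q)})`. -/
def wedge {p q : ℕ} (a : V [⋀^Fin p]→L[ℝ] ℝ) (b : V [⋀^Fin q]→L[ℝ] ℝ) :
    V [⋀^Fin (p + q)]→L[ℝ] ℝ :=
  ((p.factorial : ℝ) * (q.factorial : ℝ))⁻¹ •
    ContinuousMultilinearMap.alternatization (tensorForm a b)

/-- The exterior product of square matrices of alternating forms:
`(A ∧ B)^{ij} = ∑_k A^{ik} ∧ B^{kj}`. -/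
def matWedge {L p q : ℕ} (A : Matrix (Fin L) (Fin L) (V [⋀^Fin p]→L[ℝ] ℝ))
    (B : Matrix (Fin L) (Fin L) (V [⋀^Fin q]→L[ℝ] ℝ)) :
    Matrix (Fin L) (Fin L) (V [⋀^Fin (p + q)]→L[ℝ] ℝ) :=
  fun i j => ∑ k, wedge (A i k) (B k j)

end Wedge

section Forms

variable {E : Type*} [NormedAddCommGroup E] [NormedSpace ℝ E] {H : Type*} [TopologicalSpace H]
  {E' : Type*} [NormedAddCommGroup E'] [NormedSpace ℝ E'] {H' : Type*} [TopologicalSpace H']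

/-- An `L × L` matrix of differential `h`-forms on the manifold `X` (no regularity required):
to each point a matrix of alternating `h`-forms on the tangent space at that point. -/
abbrev MatForm (I : ModelWithCorners ℝ E H) (X : Type*) [TopologicalSpace X] [ChartedSpace H X]
    (L h : ℕ) : Type _ :=
  (P : X) → Matrix (Fin L) (Fin L) (TangentSpace I P [⋀^Fin h]→L[ℝ] ℝ)

/-- The entrywise pullback of a matrix of differential forms by a map between manifolds. -/
def MatForm.pullback {I : ModelWithCorners ℝ E H} {X : Type*} [TopologicalSpace X]
    [ChartedSpace H X] {I' : ModelWithCorners ℝ E' H'} {Y : Type*} [TopologicalSpace Y]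
    [ChartedSpace H' Y] {L h : ℕ} (f : X → Y) (w : MatForm I' Y L h) : MatForm I X L h :=
  fun P i j => (w (f P) i j).compContinuousLinearMap (mfderiv I I' f P)

end Forms

section Manifold

variable {M : ℕ} {X : Type*} [TopologicalSpace X] [ChartedSpace (Euc M) X]

/-- The representation of a matrix of differential forms in the chart `e`, that is, its pullback
by `e⁻¹`, a matrix of differential forms on `e.target ⊆ ℝ^M`. -/
def MatForm.inChart {L h : ℕ} (e : OpenPartialHomeomorph X (Euc M)) (w : MatForm 𝓘(ℝ, Euc M) X L h)
    (x : Euc M) : Matrix (Fin L) (Fin L) (Euc M [⋀^Fin h]→L[ℝ] ℝ) :=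
  MatForm.pullback (I := 𝓘(ℝ, Euc M)) e.symm w x

/-- A matrix of differential forms on a `C²` manifold is of class `C⁰` if its entries are
continuous in every `C²` chart. -/
def MatForm.IsC0 {L h : ℕ} (w : MatForm 𝓘(ℝ, Euc M) X L h) : Prop :=
  ∀ e ∈ IsManifold.maximalAtlas 𝓘(ℝ, Euc M) 2 X, ∀ i j,
    ContinuousOn (fun x => MatForm.inChart e w x i j) e.target

/-- The coefficient `F` of an alternating `n`-form `F dx₁ ∧ ⋯ ∧ dx_M` on `ℝ^M`, `n = M`. -/
def topCoeff {n : ℕ} (hn : n = M) (a : Euc M [⋀^Fin n]→L[ℝ] ℝ) : ℝ :=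
  a fun i => EuclideanSpace.single (Fin.cast hn i) 1

/-- `μ` is the distributional exterior derivative of `lam`:
`∫ lam ∧ dψ = (-1)^(h+1) ∫ μ ∧ ψ` for all matrix-valued test forms `ψ` of degree `q = M - h - 1`,
of class `C²`, with compact support in the domain of a `C²` chart. The test form and the integrals
are written in that chart, so that no orientation of the manifold is needed (reversing the
orientation of the chart changes the sign of both sides). If `M < h + 1` there are no test
forms, and `μ` vanishes because its degree exceeds `M`. -/
def MatForm.IsDED {L h : ℕ} (lam : MatForm 𝓘(ℝ, Euc M) X L h)
    (μ : MatForm 𝓘(ℝ, Euc M) X L (h + 1)) : Prop :=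
  ∀ e ∈ IsManifold.maximalAtlas 𝓘(ℝ, Euc M) 2 X, ∀ (q : ℕ) (hq : h + 1 + q = M)
    (ψ : Matrix (Fin L) (Fin L) (Euc M → Euc M [⋀^Fin q]→L[ℝ] ℝ)),
    (∀ i j, ContDiff ℝ 2 (ψ i j) ∧ HasCompactSupport (ψ i j) ∧ tsupport (ψ i j) ⊆ e.target) →
    ∀ i j,
      ∫ x in e.target, topCoeff (n := h + (q + 1)) (by omega)
          (matWedge (MatForm.inChart e lam x) (fun k l => extDeriv (ψ k l) x) i j) =
        (-1 : ℝ) ^ (h + 1) * ∫ x in e.target, topCoeff hq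
          (matWedge (MatForm.inChart e μ x) (fun k l => ψ k l x) i j)

/-- `P` is an `m`-density point of `A`: in some `C¹` chart `e` around `P`, the Lebesgue measure of
`B_r(e P) \ e (A ∩ e.source)` is `o(r^m)` as `r → 0+`. -/
def IsDensityPoint (m : ℝ) (A : Set X) (P : X) : Prop :=
  ∃ e ∈ IsManifold.maximalAtlas 𝓘(ℝ, Euc M) 1 X, P ∈ e.source ∧
    (fun r : ℝ => volume.real (Metric.ball (e P) r \ e '' (A ∩ e.source)))
      =o[𝓝[>] 0] fun r : ℝ => r ^ m

end Manifold

section MaurerCartan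

variable {L : ℕ}

/-- The space `ℝ^{L × L}` with the coordinates `z_{ij}`; `Gl(L, ℝ)` is the open subset of the
invertible matrices. -/
abbrev MatSpace (L : ℕ) : Type := Fin L → Fin L → ℝ

/-- The coordinate differential `dz_{kj}` on `ℝ^{L × L}`. -/
def dz (k j : Fin L) : MatSpace L [⋀^Fin 1]→L[ℝ] ℝ :=
  ContinuousAlternatingMap.ofSubsingleton ℝ (MatSpace L) ℝ (0 : Fin 1)
    ((ContinuousLinearMap.proj (R := ℝ) (φ := fun _ : Fin L => ℝ) j).comp
      (ContinuousLinearMap.proj (R := ℝ) (φ := fun _ : Fin L => Fin L → ℝ) k))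

/-- The matrix-valued `1`-form `z⁻¹ dz`, with entries `∑_k (z⁻¹)_{ik} dz_{kj}`, on the invertible
matrices. (Its values at singular matrices are irrelevant.) -/
def glForm (L : ℕ) : MatForm 𝓘(ℝ, MatSpace L) (MatSpace L) L 1 :=
  fun z i j =>
    (∑ k, ((Matrix.of z)⁻¹ : Matrix (Fin L) (Fin L) ℝ) i k • dz k j : MatSpace L [⋀^Fin 1]→L[ℝ] ℝ)

variable {n : ℕ} {G : Type*} [TopologicalSpace G] [ChartedSpace (Euc n) G] [Group G]

/-- The map `ι : G → Gl(L, ℝ) ⊆ ℝ^{L × L}` in the coordinates `z_{ij}`. -/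
def coords (ι : G →* GL (Fin L) ℝ) (g : G) : MatSpace L :=
  fun i j => (ι g : Matrix (Fin L) (Fin L) ℝ) i j

/-- `ι : G → Gl(L, ℝ)` presents the Lie group `G` as a Lie subgroup of `Gl(L, ℝ)`: it is an
injective homomorphism and a smooth immersion. -/
structure IsLieSubgroupInclusion (ι : G →* GL (Fin L) ℝ) : Prop where
  injective : Function.Injective ι
  smooth : ContMDiff 𝓘(ℝ, Euc n) 𝓘(ℝ, MatSpace L) ∞ (coords ι)
  immersion : ∀ g : G,
    Function.Injective (mfderiv 𝓘(ℝ, Euc n) 𝓘(ℝ, MatSpace L) (coords ι) g)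

/-- The Maurer–Cartan form `Γ_G = ι^* (z⁻¹ dz)` of a matrix Lie group with inclusion `ι`. -/
def maurerCartan (ι : G →* GL (Fin L) ℝ) : MatForm 𝓘(ℝ, Euc n) G L 1 :=
  MatForm.pullback (coords ι) (glForm L)

end MaurerCartan

end

/-! In a chart put `g = ι ∘ f` and `θ = g⁻¹ dg`. If `f` were C², the structure equation `dθ = -θ ∧
θ` would hold pointwise; for `f` of class C¹ it survives in the sense of distributions
(`integral_maurerCartan`), because second distributional derivatives commute. Hence the continuous
form `φ - θ` has the continuous distributional derivative `m = δφ + θ ∧ θ`.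

Let `B` be the set where `φ = θ` in the chart, and test against bumps `η_r` supported in the ball of
radius `r` at `x₀`. Since `φ - θ` vanishes on `B` and `|dη_r| ≤ C / r`, the integral of `(φ - θ) ∧
dη_r` is at most a constant times `r⁻¹` times the measure of the ball minus `B`, which is `o(r^M)`
at an (M+1)-density point. The other side of the identity is `m(x₀) I r^M + o(r^M)` with `I > 0`, so
`m(x₀) = 0` (`eq_zero_of_superdensity`). Such a point lies in the closure of `B`, so `φ = θ` there
by continuity, and `m(x₀) = 0` becomes the claim.

The remaining work is translation. Test forms `η κ`, with `κ` the volume form contracted by two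
constant vectors `a`, `b`, turn the definition of `δφ` into a scalar identity for the values on `(a,
b)`. Superdensity is carried from the chart in which it is given to the chart in use by a bound on
the measure of C¹ images. -/

noncomputable section

/-! ### Antisymmetrized products as Laplace expansions. -/

section PermSums

/-- A permutation is determined by the image `i` of `0` and a permutation of the rest. The inverse
of `i.cycleRange` is the representative because it has sign `(-1)^i` and keeps the other indices in
order, so that they appear as `removeNth`. -/
theorem sum_perm_fin_succ {p : ℕ} (F : Equiv.Perm (Fin (p + 1)) → ℝ) :
    ∑ σ, F σ = ∑ i : Fin (p + 1), ∑ τ : Equiv.Perm (Fin p),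
      F (i.cycleRange.symm * Equiv.Perm.decomposeFin.symm (0, τ)) := by
  rw [← Fintype.sum_prod_type' (f := fun i τ =>
    F ((Fin.cycleRange i).symm * Equiv.Perm.decomposeFin.symm (0, τ)))]
  symm
  refine Function.Bijective.sum_comp (e := fun x : Fin (p + 1) × Equiv.Perm (Fin p) =>
    (Fin.cycleRange x.1).symm * Equiv.Perm.decomposeFin.symm (0, x.2)) ?_ F
  rw [Fintype.bijective_iff_injective_and_card]
  constructor
  · rintro ⟨i, τ⟩ ⟨j, ρ⟩ h
    have h0 : i = j := by
      have := congrArg (fun s : Equiv.Perm (Fin (p + 1)) => s 0) h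
      simpa using this
    subst h0
    have h1 := mul_left_cancel h
    have h2 := Equiv.Perm.decomposeFin.symm.injective h1
    simpa using h2
  · simp [Fintype.card_perm, Nat.factorial_succ]

theorem sum_sign_perm_fin_succ {V : Type*} {p : ℕ} (F : (Fin (p + 1) → V) → ℝ)
    (v : Fin (p + 1) → V) :
    ∑ σ : Equiv.Perm (Fin (p + 1)), Equiv.Perm.sign σ • F (v ∘ σ) =
      ∑ i : Fin (p + 1), (-1 : ℝ) ^ (i : ℕ) * ∑ τ : Equiv.Perm (Fin p),
        Equiv.Perm.sign τ • F (Fin.cons (v i) (i.removeNth v ∘ τ)) := by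
  rw [sum_perm_fin_succ]
  refine Finset.sum_congr rfl fun i _ => ?_
  rw [Finset.mul_sum]
  refine Finset.sum_congr rfl fun τ _ => ?_
  have h1 : v ∘ (i.cycleRange.symm * Equiv.Perm.decomposeFin.symm (0, τ) :
      Equiv.Perm (Fin (p + 1))) = Fin.cons (v i) (i.removeNth v ∘ τ) := by
    funext j
    refine Fin.cases ?_ (fun j => ?_) j
    · simp
    · simp [Fin.removeNth]
  rw [h1, Equiv.Perm.sign_mul, Equiv.Perm.sign_symm, Fin.sign_cycleRange,
    Equiv.Perm.decomposeFin.symm_sign]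
  simp [mul_smul, Units.smul_def]

variable {V : Type*} [NormedAddCommGroup V] [NormedSpace ℝ V]

/-- Antisymmetrization of the product of a `1`-form and a `p`-form. -/
theorem sum_sign_perm_mul {p : ℕ} (α : V → ℝ) (b : V [⋀^Fin p]→L[ℝ] ℝ) (v : Fin (p + 1) → V) :
    ∑ σ : Equiv.Perm (Fin (p + 1)), Equiv.Perm.sign σ •
        (α (v (σ 0)) * b (fun i => v (σ i.succ))) =
      (p.factorial : ℝ) * ∑ i : Fin (p + 1), (-1 : ℝ) ^ (i : ℕ) * (α (v i) * b (i.removeNth v)) := by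
  have h := sum_sign_perm_fin_succ (fun w => α (w 0) * b (fun i => w i.succ)) v
  simp only [Function.comp_apply] at h
  rw [h, Finset.mul_sum]
  refine Finset.sum_congr rfl fun i _ => ?_
  -- As `b` alternates, `τ` contributes its sign twice; all `p!` terms agree.
  have h1 : ∀ τ : Equiv.Perm (Fin p), Equiv.Perm.sign τ •
      (α ((Fin.cons (v i) (i.removeNth v ∘ τ) : Fin (p + 1) → V) 0) *
        b (fun j => (Fin.cons (v i) (i.removeNth v ∘ τ) : Fin (p + 1) → V) j.succ)) =
      α (v i) * b (i.removeNth v) := by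
    intro τ
    simp only [Fin.cons_zero, Fin.cons_succ]
    have : b (fun j => (i.removeNth v ∘ τ) j) = Equiv.Perm.sign τ • b (i.removeNth v) :=
      b.toAlternatingMap.map_perm _ τ
    rw [this, mul_smul_comm, smul_smul, Int.units_mul_self, one_smul]
  rw [Finset.sum_congr rfl fun τ _ => h1 τ]
  simp [Fintype.card_perm]
  ring

/-- Splitting off the image of `0` leaves the sum of `sum_sign_perm_mul` for `β` and `b`, which
supplies the factor `q!`. -/
theorem sum_sign_perm_mul_mul {q : ℕ} (α β : V → ℝ) (b : V [⋀^Fin q]→L[ℝ] ℝ)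
    (v : Fin (q + 2) → V) :
    ∑ σ : Equiv.Perm (Fin (q + 2)), Equiv.Perm.sign σ •
        (α (v (σ 0)) * β (v (σ 1)) * b (fun i => v (σ i.succ.succ))) =
      (q.factorial : ℝ) * ∑ i : Fin (q + 2), (-1 : ℝ) ^ (i : ℕ) * (α (v i) *
        ∑ j : Fin (q + 1), (-1 : ℝ) ^ (j : ℕ) *
          (β (i.removeNth v j) * b (j.removeNth (i.removeNth v)))) := by
  have h := sum_sign_perm_fin_succ (fun w => α (w 0) * β (w 1) * b (fun i => w i.succ.succ)) v
  simp only [Function.comp_apply] at h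
  rw [h, Finset.mul_sum]
  refine Finset.sum_congr rfl fun i _ => ?_
  have h2 := sum_sign_perm_mul β b (i.removeNth v)
  have h1 : ∀ τ : Equiv.Perm (Fin (q + 1)), Equiv.Perm.sign τ •
      (α ((Fin.cons (v i) (i.removeNth v ∘ τ) : Fin (q + 2) → V) 0) *
        β ((Fin.cons (v i) (i.removeNth v ∘ τ) : Fin (q + 2) → V) 1) *
        b (fun j => (Fin.cons (v i) (i.removeNth v ∘ τ) : Fin (q + 2) → V) j.succ.succ)) =
      α (v i) * (Equiv.Perm.sign τ •
        (β (i.removeNth v (τ 0)) * b (fun j => i.removeNth v (τ j.succ)))) := by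
    intro τ
    rw [← Fin.succ_zero_eq_one]
    simp only [Fin.cons_zero, Fin.cons_succ, Function.comp_apply]
    rw [mul_assoc, mul_smul_comm]
  rw [Finset.sum_congr rfl fun τ _ => h1 τ, ← Finset.mul_sum, h2]
  ring

end PermSums

/-! ### The volume form and its contractions. -/

section Volume

/-- The determinant `dx₁ ∧ ⋯ ∧ dx_m` as a continuous alternating form on `ℝ^m`. -/
def detForm (m : ℕ) : Euc m [⋀^Fin m]→L[ℝ] ℝ :=
  { (EuclideanSpace.basisFun (Fin m) ℝ).toBasis.det with
    cont := by
      change Continuous fun v : Fin m → Euc m => (EuclideanSpace.basisFun (Fin m) ℝ).toBasis.det v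
      simp only [Module.Basis.det_apply]
      refine Continuous.matrix_det ?_
      refine continuous_matrix fun i j => ?_
      simp only [Module.Basis.toMatrix_apply, OrthonormalBasis.coe_toBasis_repr_apply,
        EuclideanSpace.basisFun_repr]
      fun_prop }

theorem detForm_single (m : ℕ) : detForm m (fun i => EuclideanSpace.single i 1) = 1 := by
  have h := (EuclideanSpace.basisFun (Fin m) ℝ).toBasis.det_self
  have h2 : ((EuclideanSpace.basisFun (Fin m) ℝ).toBasis : Fin m → Euc m) =
    fun i => EuclideanSpace.single i 1 := by ext1 i; simp
  rw [h2] at h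
  exact h

theorem ContinuousAlternatingMap.eq_zero_of_finrank_lt {V : Type*} [NormedAddCommGroup V]
    [NormedSpace ℝ V] [FiniteDimensional ℝ V] {k : ℕ} (hk : Module.finrank ℝ V < k)
    (b : V [⋀^Fin k]→L[ℝ] ℝ) : b = 0 := by
  ext v
  refine b.toAlternatingMap.map_linearDependent v fun h => ?_
  have := h.fintype_card_le_finrank
  simp at this
  omega

/-- Contraction of `α ∧ dx₁ ∧ ⋯ ∧ dx_m = 0` with a vector `X`. -/
theorem sum_mul_detForm_cons {p : ℕ} (α : Euc (p + 1) →L[ℝ] ℝ) (X : Euc (p + 1))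
    (v : Fin (p + 1) → Euc (p + 1)) :
    ∑ i : Fin (p + 1), (-1 : ℝ) ^ (i : ℕ) *
        (α (v i) * detForm (p + 1) (Fin.cons X (i.removeNth v))) = α X * detForm (p + 1) v := by
  have h0 := ContinuousAlternatingMap.eq_zero_of_finrank_lt (by simp)
    (ContinuousAlternatingMap.alternatizeUncurryFin (α.smulRight (detForm (p + 1))))
  have h1 := congrArg (fun b => b (Fin.cons X v)) h0
  rw [ContinuousAlternatingMap.alternatizeUncurryFin_apply, Fin.sum_univ_succ] at h1
  have hr : ∀ i : Fin (p + 1), i.succ.removeNth (Fin.cons X v : Fin (p + 2) → Euc (p + 1)) =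
      (Fin.cons X (i.removeNth v) : Fin (p + 1) → Euc (p + 1)) := by
    intro i
    funext j
    refine Fin.cases ?_ (fun j => ?_) j
    · simp [Fin.removeNth]
    · simp [Fin.removeNth]
  have hr0 : (0 : Fin (p + 2)).removeNth (Fin.cons X v : Fin (p + 2) → Euc (p + 1)) = v := by
    funext j
    simp [Fin.removeNth]
  simp only [hr, hr0, Fin.val_zero, pow_zero, Fin.cons_zero, Fin.cons_succ, one_smul, Fin.val_succ,
    ContinuousLinearMap.smulRight_apply, ContinuousAlternatingMap.smul_apply,
    pow_succ, smul_eq_mul, Int.reduceNeg, mul_neg, mul_one,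
    neg_smul, Finset.sum_neg_distrib] at h1
  change _ = (0 : ℝ) at h1
  have h2 : ∀ i : Fin (p + 1), (-1 : ℝ) ^ (i : ℕ) *
        (α (v i) * detForm (p + 1) (Fin.cons X (i.removeNth v))) = ((-1 : ℤ) ^ (i : ℕ)) •
        (α (v i) * detForm (p + 1) (Fin.cons X (i.removeNth v))) := by
    intro i; simp
  rw [Finset.sum_congr rfl fun i _ => h2 i]
  linarith

/-- The constant form `dx₁ ∧ ⋯ ∧ dx_{q+2}` contracted with two vectors. -/
def contractedDet (q : ℕ) (a b : Euc (q + 2)) : Euc (q + 2) [⋀^Fin q]→L[ℝ] ℝ :=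
  ((detForm (q + 2)).curryLeft a).curryLeft b

theorem contractedDet_apply (q : ℕ) (a b : Euc (q + 2)) (w : Fin q → Euc (q + 2)) :
    contractedDet q a b w = detForm (q + 2) (Fin.cons a (Fin.cons b w)) := rfl

/-- This is `sum_mul_detForm_cons` at the vectors `(b, w)`: its term `i = 0` gives `β b`, and the
other terms carry the opposite sign because their index is shifted by one. -/
theorem sum_mul_contractedDet {q : ℕ} (β : Euc (q + 2) →L[ℝ] ℝ) (a b : Euc (q + 2))
    (w : Fin (q + 1) → Euc (q + 2)) :
    ∑ j : Fin (q + 1), (-1 : ℝ) ^ (j : ℕ) * (β (w j) * contractedDet q a b (j.removeNth w)) =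
      β b * detForm (q + 2) (Fin.cons a w) - β a * detForm (q + 2) (Fin.cons b w) := by
  have h := sum_mul_detForm_cons β a (Fin.cons b w)
  rw [Fin.sum_univ_succ] at h
  have hr : ∀ i : Fin (q + 1), i.succ.removeNth (Fin.cons b w : Fin (q + 2) → Euc (q + 2)) =
      (Fin.cons b (i.removeNth w) : Fin (q + 1) → Euc (q + 2)) := by
    intro i
    funext j
    refine Fin.cases ?_ (fun j => ?_) j
    · simp [Fin.removeNth]
    · simp [Fin.removeNth]
  have hr0 : (0 : Fin (q + 2)).removeNth (Fin.cons b w : Fin (q + 2) → Euc (q + 2)) = w := by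
    funext j
    simp [Fin.removeNth]
  simp only [hr, hr0, Fin.val_zero, pow_zero, Fin.cons_zero, Fin.cons_succ, one_mul, Fin.val_succ,
    pow_succ, mul_neg, mul_one, neg_mul, Finset.sum_neg_distrib] at h
  simp only [contractedDet_apply]
  linarith

theorem sum_mul_sum_mul_contractedDet {q : ℕ} (α β : Euc (q + 2) →L[ℝ] ℝ) (a b : Euc (q + 2))
    (v : Fin (q + 2) → Euc (q + 2)) :
    ∑ i : Fin (q + 2), (-1 : ℝ) ^ (i : ℕ) * (α (v i) *
        ∑ j : Fin (q + 1), (-1 : ℝ) ^ (j : ℕ) *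
          (β (i.removeNth v j) * contractedDet q a b (j.removeNth (i.removeNth v)))) =
      (α a * β b - α b * β a) * detForm (q + 2) v := by
  have h1 := sum_mul_detForm_cons α a v
  have h2 := sum_mul_detForm_cons α b v
  simp only [sum_mul_contractedDet]
  calc _ = β b * ∑ i : Fin (q + 2), (-1 : ℝ) ^ (i : ℕ) *
        (α (v i) * detForm (q + 2) (Fin.cons a (i.removeNth v))) -
        β a * ∑ i : Fin (q + 2), (-1 : ℝ) ^ (i : ℕ) *
        (α (v i) * detForm (q + 2) (Fin.cons b (i.removeNth v))) := by
        rw [Finset.mul_sum, Finset.mul_sum, ← Finset.sum_sub_distrib]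
        exact Finset.sum_congr rfl fun i _ => by ring
    _ = _ := by rw [h1, h2]; ring

end Volume

/-! ### Wedge products with the contracted volume form. -/

section TopCoefficients

theorem wedge_apply {V : Type*} [AddCommGroup V] [Module ℝ V] [TopologicalSpace V] {p q : ℕ}
    (a : V [⋀^Fin p]→L[ℝ] ℝ) (b : V [⋀^Fin q]→L[ℝ] ℝ) (v : Fin (p + q) → V) :
    wedge a b v = ((p.factorial : ℝ) * (q.factorial : ℝ))⁻¹ *
      ∑ σ : Equiv.Perm (Fin (p + q)), Equiv.Perm.sign σ •
        (a (fun i => v (σ (Fin.castAdd q i))) * b (fun i => v (σ (Fin.natAdd p i)))) := by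
  rw [wedge, ContinuousAlternatingMap.smul_apply, smul_eq_mul,
    ContinuousMultilinearMap.alternatization_apply_apply]
  rfl

theorem topCoeff_wedge {M p q : ℕ} (h : p + q = M)
    (a : Euc M [⋀^Fin p]→L[ℝ] ℝ) (b : Euc M [⋀^Fin q]→L[ℝ] ℝ) :
    topCoeff h (wedge a b) = ((p.factorial : ℝ) * (q.factorial : ℝ))⁻¹ *
      ∑ σ : Equiv.Perm (Fin M), Equiv.Perm.sign σ •
        (a (fun i => EuclideanSpace.single (σ (Fin.cast h (Fin.castAdd q i))) 1) *
          b (fun i => EuclideanSpace.single (σ (Fin.cast h (Fin.natAdd p i))) 1)) := by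
  subst h
  rw [topCoeff, wedge_apply]
  rfl

theorem wedge_one_one_apply {V : Type*} [AddCommGroup V] [Module ℝ V] [TopologicalSpace V]
    (a b : V [⋀^Fin 1]→L[ℝ] ℝ) (x y : V) :
    wedge a b ![x, y] = a ![x] * b ![y] - a ![y] * b ![x] := by
  rw [wedge_apply]
  change _ * ∑ σ : Equiv.Perm (Fin 2), _ = _
  rw [show (Finset.univ : Finset (Equiv.Perm (Fin 2))) = {1, Equiv.swap 0 1} by decide]
  rw [Finset.sum_pair (by decide)]
  have hx : ∀ x : V, (fun _ : Fin 1 => x) = ![x] := fun x => by ext i; simp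
  have e1 : ∀ i : Fin 1, Fin.castAdd 1 i = (0 : Fin 2) := by decide
  have e2 : ∀ i : Fin 1, Fin.natAdd 1 i = (1 : Fin 2) := by decide
  simp only [e1, e2]
  simp [hx]
  ring

/-- Wedging with `contractedDet q a b` extracts the value on `(a, b)`, so these forms suffice as
test forms. By bilinearity `β` expands in products of coordinate covectors, for which
`sum_mul_sum_mul_contractedDet` computes the result. -/
theorem topCoeff_wedge_contractedDet {q : ℕ} (h : 1 + 1 + q = q + 2)
    (β : Euc (q + 2) [⋀^Fin (1 + 1)]→L[ℝ] ℝ) (a b : Euc (q + 2)) :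
    topCoeff h (wedge β (contractedDet q a b)) = β ![a, b] := by
  have hβ : ∀ x y : Euc (q + 2), β ![x, y] = ∑ k, ∑ l, (x k * y l) *
      β ![EuclideanSpace.single k 1, EuclideanSpace.single l 1] := by
    intro x y
    have hc1 : ∀ x y : Euc (q + 2), β ![x, y] = β.curryLeft x ![y] := fun x y => rfl
    have hc2 : ∀ x y : Euc (q + 2), β.curryLeft x ![y] = (β.curryLeft x).curryLeft y ![] :=
      fun x y => rfl
    have hs : ∀ x : Euc (q + 2), x = ∑ k, x k • EuclideanSpace.single k (1 : ℝ) := by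
      intro x
      ext i
      simp [Finset.sum_apply, Pi.single_apply]
    have h1 : β ![x, y] = ∑ l, y l * β ![x, EuclideanSpace.single l 1] := by
      simp only [hc1, hc2]
      conv_lhs => rw [hs y]
      simp only [map_sum, map_smul, ContinuousAlternatingMap.sum_apply,
        ContinuousAlternatingMap.smul_apply, smul_eq_mul]
    have h2 : ∀ l, β ![x, EuclideanSpace.single l 1] =
        ∑ k, x k * β ![EuclideanSpace.single k 1, EuclideanSpace.single l 1] := by
      intro l
      simp only [hc1]
      conv_lhs => rw [hs x]
      simp only [map_sum, map_smul, ContinuousAlternatingMap.sum_apply,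
        ContinuousAlternatingMap.smul_apply, smul_eq_mul]
    rw [h1, Finset.sum_comm]
    refine Finset.sum_congr rfl fun l _ => ?_
    rw [h2, Finset.mul_sum]
    exact Finset.sum_congr rfl fun k _ => by ring
  have hanti : β ![b, a] = -β ![a, b] := by
    have := β.toAlternatingMap.map_swap ![a, b] (i := (0 : Fin 2)) (j := 1) (by decide)
    have hsw : (![a, b] ∘ Equiv.swap (0 : Fin 2) 1) = ![b, a] := by
      funext i
      fin_cases i <;> simp
    rw [hsw] at this
    exact this
  have hproj : ∀ k l : Fin (q + 2), ∑ σ : Equiv.Perm (Fin (q + 2)), Equiv.Perm.sign σ •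
      ((EuclideanSpace.single (σ 0) (1 : ℝ) : Euc (q + 2)) k *
        (EuclideanSpace.single (σ 1) (1 : ℝ) : Euc (q + 2)) l *
        contractedDet q a b (fun i => EuclideanSpace.single (σ i.succ.succ) 1)) =
      (q.factorial : ℝ) * (a k * b l - b k * a l) := by
    intro k l
    have h1 := sum_sign_perm_mul_mul (EuclideanSpace.proj k : Euc (q + 2) →L[ℝ] ℝ)
      (EuclideanSpace.proj l : Euc (q + 2) →L[ℝ] ℝ) (contractedDet q a b)
      (fun i => EuclideanSpace.single i 1)
    rw [sum_mul_sum_mul_contractedDet, detForm_single, mul_one] at h1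
    exact h1
  have hterm : ∀ σ : Equiv.Perm (Fin (q + 2)), Equiv.Perm.sign σ •
      (β (fun i => EuclideanSpace.single (σ (Fin.cast h (Fin.castAdd q i))) 1) *
        contractedDet q a b
          (fun i => EuclideanSpace.single (σ (Fin.cast h (Fin.natAdd (1 + 1) i))) 1)) =
      ∑ k, ∑ l, β ![EuclideanSpace.single k 1, EuclideanSpace.single l 1] *
        (Equiv.Perm.sign σ • ((EuclideanSpace.single (σ 0) (1 : ℝ) : Euc (q + 2)) k *
        (EuclideanSpace.single (σ 1) (1 : ℝ) : Euc (q + 2)) l *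
        contractedDet q a b (fun i => EuclideanSpace.single (σ i.succ.succ) 1))) := by
    intro σ
    have e1 : (fun i : Fin (1 + 1) =>
        (EuclideanSpace.single (σ (Fin.cast h (Fin.castAdd q i))) 1 : Euc (q + 2))) =
        ![EuclideanSpace.single (σ 0) 1, EuclideanSpace.single (σ 1) 1] := by
      funext i
      fin_cases i <;> rfl
    have e2 : ∀ i : Fin q, Fin.cast h (Fin.natAdd (1 + 1) i) = i.succ.succ := by
      intro i
      ext
      simp
    rw [e1, hβ]
    simp only [e2]
    rw [Finset.sum_mul, Finset.smul_sum]
    refine Finset.sum_congr rfl fun k _ => ?_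
    rw [Finset.sum_mul, Finset.smul_sum]
    refine Finset.sum_congr rfl fun l _ => ?_
    simp only [Units.smul_def, zsmul_eq_mul]
    ring
  rw [topCoeff_wedge, Finset.sum_congr rfl fun σ _ => hterm σ, Finset.sum_comm]
  have hswap : ∀ k, ∑ σ : Equiv.Perm (Fin (q + 2)), ∑ l,
      β ![EuclideanSpace.single k 1, EuclideanSpace.single l 1] *
        (Equiv.Perm.sign σ • ((EuclideanSpace.single (σ 0) (1 : ℝ) : Euc (q + 2)) k *
        (EuclideanSpace.single (σ 1) (1 : ℝ) : Euc (q + 2)) l *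
        contractedDet q a b (fun i => EuclideanSpace.single (σ i.succ.succ) 1))) =
      ∑ l, (q.factorial : ℝ) * ((a k * b l) *
        β ![EuclideanSpace.single k 1, EuclideanSpace.single l 1] - (b k * a l) *
        β ![EuclideanSpace.single k 1, EuclideanSpace.single l 1]) := by
    intro k
    rw [Finset.sum_comm]
    refine Finset.sum_congr rfl fun l _ => ?_
    rw [← Finset.mul_sum, hproj]
    ring
  rw [Finset.sum_congr rfl fun k _ => hswap k]
  simp only [← Finset.mul_sum, Finset.sum_sub_distrib]
  -- The sum is `q! (β(a, b) - β(b, a)) = 2 q! β(a, b)`, which cancels the normalization `1 / (2!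
  -- q!)`.
  rw [← hβ, ← hβ, hanti]
  have hq : (q.factorial : ℝ) ≠ 0 := by exact_mod_cast q.factorial_ne_zero
  simp [Nat.factorial]
  field_simp
  ring

/-- The contracted volume form `κ` is constant, so `d(η κ) = dη ∧ κ`, and `α ∧ dη ∧ κ` extracts the
value of `α ∧ dη` on `(a, b)`. -/
theorem topCoeff_wedge_extDeriv {q : ℕ} (h : 1 + (q + 1) = q + 2)
    (α : Euc (q + 2) [⋀^Fin 1]→L[ℝ] ℝ) (η : Euc (q + 2) → ℝ) (x : Euc (q + 2))
    (hη : DifferentiableAt ℝ η x) (a b : Euc (q + 2)) :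
    topCoeff h (wedge α (extDeriv (fun y => η y • contractedDet q a b) x)) =
      α ![a] * fderiv ℝ η x b - α ![b] * fderiv ℝ η x a := by
  set α' : Euc (q + 2) →L[ℝ] ℝ :=
    (ContinuousAlternatingMap.ofSubsingleton ℝ (Euc (q + 2)) ℝ (0 : Fin 1)).symm α with hα'
  have hα : ∀ w : Fin 1 → Euc (q + 2), α w = α' (w 0) := by
    intro w
    rw [← (ContinuousAlternatingMap.ofSubsingleton ℝ (Euc (q + 2)) ℝ (0 : Fin 1)).apply_symm_apply α]
    rfl
  have hd : ∀ w : Fin (q + 1) → Euc (q + 2),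
      extDeriv (fun y => η y • contractedDet q a b) x w = ∑ j : Fin (q + 1), (-1 : ℝ) ^ (j : ℕ) *
        (fderiv ℝ η x (w j) * contractedDet q a b (j.removeNth w)) := by
    intro w
    rw [extDeriv, ContinuousAlternatingMap.alternatizeUncurryFin_apply]
    refine Finset.sum_congr rfl fun j _ => ?_
    rw [fderiv_smul_const hη]
    simp
  rw [topCoeff_wedge]
  have e1 : Fin.cast h (Fin.castAdd (q + 1) (0 : Fin 1)) = 0 := rfl
  have e2 : ∀ i : Fin (q + 1), Fin.cast h (Fin.natAdd 1 i) = i.succ := by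
    intro i
    ext
    simp
  simp only [hα, e1, e2]
  have h1 := sum_sign_perm_mul α' (extDeriv (fun y => η y • contractedDet q a b) x)
    (fun i => EuclideanSpace.single i 1)
  rw [h1]
  simp only [hd]
  rw [sum_mul_sum_mul_contractedDet, detForm_single]
  have hq : ((q + 1).factorial : ℝ) ≠ 0 := by exact_mod_cast (q + 1).factorial_ne_zero
  simp only [Nat.factorial_one, Nat.cast_one, one_mul, Matrix.cons_val_zero, mul_one]
  rw [← mul_assoc, inv_mul_cancel₀ hq]
  ring

end TopCoefficients

/-! ### The structure equation in the sense of distributions. -/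

section IntegrationByParts

variable {E : Type*} [NormedAddCommGroup E] [NormedSpace ℝ E] [FiniteDimensional ℝ E]
  [MeasurableSpace E] [BorelSpace E] {ν : Measure E} [ν.IsAddHaarMeasure]

set_option maxSynthPendingDepth 3 in
open scoped Convolution in
/-- The distributional second derivative is symmetric, for `C¹` functions. -/
theorem integral_fderiv_mul_fderiv_comm_of_hasCompactSupport {a c : E → ℝ} (ha : ContDiff ℝ 1 a)
    (hac : HasCompactSupport a) (hc : ContDiff ℝ 1 c) (hcc : HasCompactSupport c) (u w : E) :
    ∫ x, fderiv ℝ a x u * fderiv ℝ c x w ∂ν = ∫ x, fderiv ℝ a x w * fderiv ℝ c x u ∂ν := by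
  -- With the reflected function, `(a ⋆ c')(y) = ∫ a(x) c(x - y)`. One derivative can be put on `c'`
  -- and the next on `a`, so C¹ factors make the convolution twice differentiable at `0`; the
  -- symmetry of its second derivative there is the claim up to sign.
  set c' : E → ℝ := fun x => c (-x) with hc'
  have hc1 : ContDiff ℝ 1 c' := hc.comp contDiff_neg
  have hc2 : HasCompactSupport c' := hcc.comp_homeomorph (Homeomorph.neg E)
  have hdc : ∀ x v, fderiv ℝ c' (-x) v = -fderiv ℝ c x v := by
    intro x v
    have h1 : HasFDerivAt c' ((fderiv ℝ c (- -x)).comp (-ContinuousLinearMap.id ℝ E)) (-x) :=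
      ((hc.differentiable one_ne_zero) (- -x)).hasFDerivAt.comp (-x) (hasFDerivAt_id (-x)).neg
    rw [h1.fderiv]
    simp
  set B := ContinuousLinearMap.mul ℝ ℝ
  have h1 : ∀ y, HasFDerivAt (a ⋆[B, ν] c') ((a ⋆[B.precompR E, ν] fderiv ℝ c') y) y :=
    fun y => hc2.hasFDerivAt_convolution_right B ha.continuous.locallyIntegrable hc1 y
  have hdc_cont : Continuous (fderiv ℝ c') := hc1.continuous_fderiv one_ne_zero
  have h2 := hac.hasFDerivAt_convolution_left (B.precompR E) ha
    (hdc_cont.locallyIntegrable (μ := ν)) 0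
  have h3 := second_derivative_symmetric h1 h2
  let T : (E →L[ℝ] ℝ) →L[ℝ] (E →L[ℝ] ℝ) →L[ℝ] (E →L[ℝ] E →L[ℝ] ℝ) := (B.precompR E).precompL E
  have hint := HasCompactSupport.convolutionExists_right T (hc2.fderiv ℝ)
    ((ha.continuous_fderiv one_ne_zero).locallyIntegrable (μ := ν)) hdc_cont 0
  have key : ∀ p r : E, ((fderiv ℝ a ⋆[T, ν] fderiv ℝ c') 0) p r =
      -∫ x, fderiv ℝ a x p * fderiv ℝ c x r ∂ν := by
    intro p r
    rw [convolution_def, ContinuousLinearMap.integral_apply hint,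
      ContinuousLinearMap.integral_apply (hint.apply_continuousLinearMap p), ← integral_neg]
    refine integral_congr_ae (Eventually.of_forall fun x => ?_)
    have := hdc x r
    simp only [zero_sub]
    change fderiv ℝ a x p * fderiv ℝ c' (-x) r = _
    rw [this]
    ring
  have h4 : ((fderiv ℝ a ⋆[T, ν] fderiv ℝ c') 0) u w =
      ((fderiv ℝ a ⋆[T, ν] fderiv ℝ c') 0) w u := h3 u w
  rw [key, key] at h4
  exact neg_injective h4

theorem ContDiffOn.contDiff_mul_of_tsupport_subset {E : Type*} [NormedAddCommGroup E]
    [NormedSpace ℝ E] {W : Set E} (hW : IsOpen W) {k : ℕ∞ω}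
    {u η : E → ℝ} (hu : ContDiffOn ℝ k u W) (hη : ContDiff ℝ k η) (hs : tsupport η ⊆ W) :
    ContDiff ℝ k fun x => u x * η x := by
  rw [contDiff_iff_contDiffAt]
  intro x
  by_cases hx : x ∈ tsupport η
  · exact (hu.contDiffAt (hW.mem_nhds (hs hx))).mul hη.contDiffAt
  · refine (contDiffAt_const (c := (0 : ℝ))).congr_of_eventuallyEq ?_
    filter_upwards [notMem_tsupport_iff_eventuallyEq.1 hx] with y hy
    simp [hy]

theorem exists_contDiff_cutoff {E : Type*} [NormedAddCommGroup E] [NormedSpace ℝ E]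
    [FiniteDimensional ℝ E] {K W : Set E} (hK : IsCompact K) (hW : IsOpen W) (hKW : K ⊆ W) :
    ∃ χ : E → ℝ, ContDiff ℝ ∞ χ ∧ HasCompactSupport χ ∧ tsupport χ ⊆ W ∧
      ∀ x ∈ K, ∀ᶠ y in 𝓝 x, χ y = 1 := by
  obtain ⟨K', hK', hKK', hK'W⟩ := exists_compact_between hK hW hKW
  obtain ⟨f, hf1, hf0, -⟩ := exists_contMDiffMap_one_nhds_of_subset_interior (n := ⊤) 𝓘(ℝ, E)
    hK.isClosed hKK'
  have hsup : tsupport f ⊆ K' := closure_minimal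
    (fun x hx => by_contra fun h => hx (hf0 x h)) hK'.isClosed
  refine ⟨f, f.contMDiff.contDiff, hK'.of_isClosed_subset (isClosed_tsupport _) hsup,
    hsup.trans hK'W, fun x hx => ?_⟩
  rw [eventually_nhdsSet_iff_forall] at hf1
  exact hf1 x hx

/-- A cutoff equal to `1` near the support of `c` extends `w` to a compactly supported C¹ function
without changing `dw` where `dc` can be nonzero. -/
theorem integral_fderiv_mul_fderiv_comm {W : Set E} (hW : IsOpen W) {w c : E → ℝ}
    (hw : ContDiffOn ℝ 1 w W) (hc : ContDiff ℝ 1 c) (hcc : HasCompactSupport c)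
    (hcW : tsupport c ⊆ W) (a b : E) :
    ∫ x, fderiv ℝ w x a * fderiv ℝ c x b ∂ν = ∫ x, fderiv ℝ w x b * fderiv ℝ c x a ∂ν := by
  obtain ⟨χ, hχ, hχc, hχW, hχ1⟩ := exists_contDiff_cutoff hcc.isCompact hW hcW
  have h := integral_fderiv_mul_fderiv_comm_of_hasCompactSupport (ν := ν)
    (hw.contDiff_mul_of_tsupport_subset hW (hχ.of_le (by exact_mod_cast le_top)) hχW)
    (HasCompactSupport.mul_left hχc) hc hcc a b
  have hd : ∀ p r x, fderiv ℝ (fun x => w x * χ x) x p * fderiv ℝ c x r =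
      fderiv ℝ w x p * fderiv ℝ c x r := by
    intro p r x
    by_cases hx : x ∈ tsupport c
    · have : (fun x => w x * χ x) =ᶠ[𝓝 x] w := by
        filter_upwards [hχ1 x hx] with y hy
        simp [hy]
      rw [this.fderiv_eq]
    · have : fderiv ℝ c x = 0 := by
        have h0 := (notMem_tsupport_iff_eventuallyEq.1 hx).fderiv_eq (𝕜 := ℝ)
        rw [h0]
        exact fderiv_const_apply (0 : ℝ)
      simp [this]
  simpa only [hd] using h

theorem ContinuousOn.integrable_mul_of_tsupport_subset {E : Type*} [NormedAddCommGroup E]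
    [MeasurableSpace E] [BorelSpace E] {ν : Measure E} [IsFiniteMeasureOnCompacts ν] {W : Set E} (hW : IsOpen W) {u η : E → ℝ}
    (hu : ContinuousOn u W) (hη : Continuous η) (hηc : HasCompactSupport η)
    (hs : tsupport η ⊆ W) : Integrable (fun x => u x * η x) ν := by
  have hc : Continuous fun x => u x * η x := by
    refine continuous_of_tsupport fun x hx => ?_
    have hx' : x ∈ tsupport η := closure_mono (Function.support_mul_subset_right u η) hx
    exact (hu.continuousAt (hW.mem_nhds (hs hx'))).mul hη.continuousAt
  exact hc.integrable_of_hasCompactSupport hηc.mul_left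

theorem fderiv_eq_zero_of_notMem_tsupport {E : Type*} [NormedAddCommGroup E]
    [NormedSpace ℝ E] {η : E → ℝ} {x : E} (hx : x ∉ tsupport η) :
    fderiv ℝ η x = 0 :=
  image_eq_zero_of_notMem_tsupport fun h => hx (tsupport_fderiv_subset ℝ h)

theorem ContDiffOn.continuousOn_fderiv_apply {E : Type*} [NormedAddCommGroup E]
    [NormedSpace ℝ E] {W : Set E} (hW : IsOpen W) {u : E → ℝ}
    (hu : ContDiffOn ℝ 1 u W) (v : E) : ContinuousOn (fun x => fderiv ℝ u x v) W :=
  (hu.continuousOn_fderiv_of_isOpen hW le_rfl).clm_apply continuousOn_const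

/-- The product rule `d(u dw) = du ∧ dw` in the sense of distributions, for `C¹` functions. -/
theorem integral_mul_fderiv_mul_fderiv_sub {W : Set E} (hW : IsOpen W) {u w η : E → ℝ}
    (hu : ContDiffOn ℝ 1 u W) (hw : ContDiffOn ℝ 1 w W) (hη : ContDiff ℝ 1 η)
    (hηc : HasCompactSupport η) (hηW : tsupport η ⊆ W) (a b : E) :
    ∫ x, (u x * fderiv ℝ w x a * fderiv ℝ η x b - u x * fderiv ℝ w x b * fderiv ℝ η x a) ∂ν =
      ∫ x, (fderiv ℝ u x a * fderiv ℝ w x b - fderiv ℝ u x b * fderiv ℝ w x a) * η x ∂ν := by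
  have hc := hu.contDiff_mul_of_tsupport_subset hW hη hηW
  have hcc : HasCompactSupport fun x => u x * η x := hηc.mul_left
  have hcW : tsupport (fun x => u x * η x) ⊆ W :=
    (closure_mono (Function.support_mul_subset_right u η)).trans hηW
  -- Testing the symmetry against `u η` and expanding `d(u η)` yields one term with `dη` and one
  -- with `du`: the two sides of the claim.
  have h := integral_fderiv_mul_fderiv_comm (ν := ν) hW hw hc hcc hcW a b
  have hdη : ∀ v, Continuous fun x => fderiv ℝ η x v := fun v =>
    (hη.continuous_fderiv one_ne_zero).clm_apply continuous_const
  have hdηc : ∀ v, HasCompactSupport fun x => fderiv ℝ η x v := fun v =>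
    hηc.fderiv_apply ℝ v
  have hdηW : ∀ v, tsupport (fun x => fderiv ℝ η x v) ⊆ W := fun v =>
    (tsupport_fderiv_apply_subset ℝ v).trans hηW
  have hdw := fun v => hw.continuousOn_fderiv_apply hW v
  have hdu := fun v => hu.continuousOn_fderiv_apply hW v
  have i1 : ∀ p r, Integrable (fun x => (u x * fderiv ℝ w x p) * fderiv ℝ η x r) ν := fun p r =>
    ContinuousOn.integrable_mul_of_tsupport_subset hW (hu.continuousOn.mul (hdw p)) (hdη r)
      (hdηc r) (hdηW r)
  have i2 : ∀ p r, Integrable (fun x => (fderiv ℝ u x r * fderiv ℝ w x p) * η x) ν := fun p r =>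
    ContinuousOn.integrable_mul_of_tsupport_subset hW ((hdu r).mul (hdw p)) hη.continuous hηc hηW
  have hd : ∀ p r x, fderiv ℝ w x p * fderiv ℝ (fun x => u x * η x) x r =
      u x * fderiv ℝ w x p * fderiv ℝ η x r + fderiv ℝ u x r * fderiv ℝ w x p * η x := by
    intro p r x
    by_cases hx : x ∈ tsupport η
    · have hux : DifferentiableAt ℝ u x :=
        (hu.differentiableOn one_ne_zero).differentiableAt (hW.mem_nhds (hηW hx))
      rw [fderiv_fun_mul hux (hη.differentiable one_ne_zero x)]
      simp
      ring
    · have hx' : x ∉ tsupport fun x => u x * η x :=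
        fun h => hx (closure_mono (Function.support_mul_subset_right u η) h)
      rw [fderiv_eq_zero_of_notMem_tsupport hx, fderiv_eq_zero_of_notMem_tsupport hx',
        image_eq_zero_of_notMem_tsupport hx]
      simp
  simp only [hd] at h
  rw [integral_add (i1 _ _) (i2 _ _), integral_add (i1 _ _) (i2 _ _)] at h
  rw [integral_sub (i1 _ _) (i1 _ _)]
  simp only [sub_mul]
  rw [integral_sub (i2 _ _) (i2 _ _)]
  linarith

/-- The structure equation `d(g⁻¹ dg) = -(g⁻¹ dg) ∧ (g⁻¹ dg)` in the sense of distributions, for a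
matrix-valued `C¹` map `g` with inverse `h`. -/
theorem integral_maurerCartan {L : ℕ} {W : Set E} (hW : IsOpen W) {g h : E → Fin L → Fin L → ℝ}
    (hg : ∀ i j, ContDiffOn ℝ 1 (fun x => g x i j) W)
    (hh : ∀ i j, ContDiffOn ℝ 1 (fun x => h x i j) W)
    (hgh : ∀ x ∈ W, ∀ i j, ∑ k, g x i k * h x k j = if i = j then 1 else 0)
    (hhg : ∀ x ∈ W, ∀ i j, ∑ k, h x i k * g x k j = if i = j then 1 else 0)
    {θ : Fin L → Fin L → E → E → ℝ}
    (hθ : ∀ i j, ∀ x ∈ W, ∀ v, θ i j x v = ∑ k, h x i k * fderiv ℝ (fun y => g y k j) x v)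
    {η : E → ℝ} (hη : ContDiff ℝ 1 η)
    (hηc : HasCompactSupport η) (hηW : tsupport η ⊆ W) (i j : Fin L) (a b : E) :
    ∫ x, (θ i j x a * fderiv ℝ η x b - θ i j x b * fderiv ℝ η x a) ∂ν =
      ∫ x, -(∑ k, (θ i k x a * θ k j x b - θ i k x b * θ k j x a)) * η x ∂ν := by
  have hdη : ∀ v, Continuous fun x => fderiv ℝ η x v := fun v =>
    (hη.continuous_fderiv one_ne_zero).clm_apply continuous_const
  have hdηc : ∀ v, HasCompactSupport fun x => fderiv ℝ η x v := fun v =>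
    hηc.fderiv_apply ℝ v
  have hdηW : ∀ v, tsupport (fun x => fderiv ℝ η x v) ⊆ W := fun v =>
    (tsupport_fderiv_apply_subset ℝ v).trans hηW
  have i1 : ∀ k p r, Integrable
      (fun x => (h x i k * fderiv ℝ (fun y => g y k j) x p) * fderiv ℝ η x r) ν := fun k p r =>
    ContinuousOn.integrable_mul_of_tsupport_subset hW
      ((hh i k).continuousOn.mul ((hg k j).continuousOn_fderiv_apply hW p)) (hdη r)
      (hdηc r) (hdηW r)
  have i12 : ∀ k, Integrable
      (fun x => h x i k * fderiv ℝ (fun y => g y k j) x a * fderiv ℝ η x b -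
        h x i k * fderiv ℝ (fun y => g y k j) x b * fderiv ℝ η x a) ν := fun k =>
    (i1 k a b).sub (i1 k b a)
  have i2 : ∀ k, Integrable (fun x => (fderiv ℝ (fun y => h y i k) x a *
      fderiv ℝ (fun y => g y k j) x b - fderiv ℝ (fun y => h y i k) x b *
      fderiv ℝ (fun y => g y k j) x a) * η x) ν := fun k =>
    ContinuousOn.integrable_mul_of_tsupport_subset hW
      ((((hh i k).continuousOn_fderiv_apply hW a).mul ((hg k j).continuousOn_fderiv_apply hW b)).sub
      (((hh i k).continuousOn_fderiv_apply hW b).mul ((hg k j).continuousOn_fderiv_apply hW a)))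
      hη.continuous hηc hηW
  -- the derivative of the inverse matrix
  have hdh : ∀ x ∈ W, ∀ k v, fderiv ℝ (fun y => h y i k) x v = -∑ l, θ i l x v * h x l k := by
    intro x hx k v
    have hgd : ∀ i j, DifferentiableAt ℝ (fun y => g y i j) x := fun i j =>
      ((hg i j).differentiableOn one_ne_zero).differentiableAt (hW.mem_nhds hx)
    have hhd : ∀ i j, DifferentiableAt ℝ (fun y => h y i j) x := fun i j =>
      ((hh i j).differentiableOn one_ne_zero).differentiableAt (hW.mem_nhds hx)
    -- Differentiating `h g = 1` gives `dh · g = -h dg = -θ`; multiplication by `h` on the right,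
    -- using `g h = 1`, then isolates `dh`.
    have hz : ∀ m, ∑ l, fderiv ℝ (fun y => h y i l) x v * g x l m = -θ i m x v := by
      intro m
      have h1 : (fun y => ∑ l, h y i l * g y l m) =ᶠ[𝓝 x] fun _ => if i = m then (1 : ℝ) else 0 := by
        filter_upwards [hW.mem_nhds hx] with y hy using hhg y hy i m
      have h2 := congrArg (fun T => T v) (h1.fderiv_eq (𝕜 := ℝ))
      rw [fderiv_fun_sum (𝕜 := ℝ) (A := fun l y => h y i l * g y l m)
        fun l _ => (hhd i l).mul (hgd l m)] at h2
      simp only [fderiv_fun_const, Pi.zero_apply, zero_apply,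
        sum_apply] at h2
      rw [hθ i m x hx v]
      have h3 : ∀ l, (fderiv ℝ (fun y => h y i l * g y l m) x) v =
          h x i l * fderiv ℝ (fun y => g y l m) x v + fderiv ℝ (fun y => h y i l) x v * g x l m := by
        intro l
        rw [fderiv_fun_mul (hhd i l) (hgd l m)]
        simp
        ring
      simp only [h3, Finset.sum_add_distrib] at h2
      linarith
    calc fderiv ℝ (fun y => h y i k) x v
        = ∑ l, fderiv ℝ (fun y => h y i l) x v * (if l = k then 1 else 0) := by simp
      _ = ∑ l, fderiv ℝ (fun y => h y i l) x v * ∑ m, g x l m * h x m k := by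
          simp only [hgh x hx]
      _ = ∑ m, (∑ l, fderiv ℝ (fun y => h y i l) x v * g x l m) * h x m k := by
          simp only [Finset.mul_sum, Finset.sum_mul]
          rw [Finset.sum_comm]
          exact Finset.sum_congr rfl fun m _ => Finset.sum_congr rfl fun l _ => by ring
      _ = _ := by simp only [hz, neg_mul, Finset.sum_neg_distrib]
  -- From `dh = -θ h` and `h dg = θ`; antisymmetrized, this says `dh ∧ dg = -θ ∧ θ`.
  have hprod : ∀ x ∈ W, ∀ p r, ∑ k, fderiv ℝ (fun y => h y i k) x p *
      fderiv ℝ (fun y => g y k j) x r = -∑ k, θ i k x p * θ k j x r := by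
    intro x hx p r
    simp only [hdh x hx, hθ _ j x hx r, neg_mul, Finset.sum_neg_distrib, Finset.sum_mul,
      Finset.mul_sum]
    rw [Finset.sum_comm]
    congr 1
    exact Finset.sum_congr rfl fun m _ => Finset.sum_congr rfl fun l _ => by ring
  calc ∫ x, (θ i j x a * fderiv ℝ η x b - θ i j x b * fderiv ℝ η x a) ∂ν
      = ∫ x, ∑ k, (h x i k * fderiv ℝ (fun y => g y k j) x a * fderiv ℝ η x b -
          h x i k * fderiv ℝ (fun y => g y k j) x b * fderiv ℝ η x a) ∂ν := by
        refine integral_congr_ae (Eventually.of_forall fun x => ?_)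
        by_cases hx : x ∈ tsupport η
        · simp only [hθ i j x (hηW hx), Finset.sum_sub_distrib, Finset.sum_mul]
        · simp [fderiv_eq_zero_of_notMem_tsupport hx]
    _ = ∑ k, ∫ x, (fderiv ℝ (fun y => h y i k) x a *
          fderiv ℝ (fun y => g y k j) x b - fderiv ℝ (fun y => h y i k) x b *
          fderiv ℝ (fun y => g y k j) x a) * η x ∂ν := by
        rw [integral_finsetSum _ fun k _ => i12 k]
        exact Finset.sum_congr rfl fun k _ =>
          integral_mul_fderiv_mul_fderiv_sub hW (hh i k) (hg k j) hη hηc hηW a b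
    _ = ∫ x, -(∑ k, (θ i k x a * θ k j x b - θ i k x b * θ k j x a)) * η x ∂ν := by
        rw [← integral_finsetSum _ fun k _ => i2 k]
        refine integral_congr_ae (Eventually.of_forall fun x => ?_)
        by_cases hx : x ∈ tsupport η
        · simp only [← Finset.sum_mul, Finset.sum_sub_distrib, hprod x (hηW hx)]
          ring
        · simp [image_eq_zero_of_notMem_tsupport hx]

end IntegrationByParts

/-! ### Blow-up at a superdensity point and invariance of superdensity. -/

section BlowUp

open Metric

variable {E : Type*} [NormedAddCommGroup E] [NormedSpace ℝ E] [FiniteDimensional ℝ E]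
  [MeasurableSpace E] [BorelSpace E] {ν : Measure E} [ν.IsAddHaarMeasure]

/-- `S` may be nonmeasurable, since density points refer to outer measure; its measurable hull has
the same measure, and the bound persists there because `F` vanishes off `S`. -/
theorem norm_integral_le_mul_measureReal {E : Type*} [MeasurableSpace E] {ν : Measure E}
    {F : E → ℝ} {S : Set E} (hS : ν S ≠ ⊤) {C : ℝ} (h0 : ∀ x ∉ S, F x = 0)
    (hC : ∀ x ∈ S, |F x| ≤ C) : |∫ x, F x ∂ν| ≤ C * ν.real S := by
  have h1 : ∫ x, F x ∂ν = ∫ x in toMeasurable ν S, F x ∂ν :=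
    (setIntegral_eq_integral_of_forall_compl_eq_zero
      fun x hx => h0 x fun h => hx (subset_toMeasurable ν S h)).symm
  rcases S.eq_empty_or_nonempty with rfl | ⟨y, hy⟩
  · simp [h0]
  have hC0 : 0 ≤ C := (abs_nonneg _).trans (hC y hy)
  have h2 : ∀ x, ‖F x‖ ≤ C := fun x => by
    by_cases hx : x ∈ S
    · exact hC x hx
    · simp [h0 x hx, hC0]
  rw [h1]
  refine (norm_setIntegral_le_of_norm_le_const (by rwa [measure_toMeasurable, lt_top_iff_ne_top])
    fun x _ => h2 x).trans ?_
  rw [measureReal_def, measure_toMeasurable, measureReal_def]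

/-- Rescaled bump functions concentrating at a point. -/
theorem exists_rescaled_bump (ν : Measure E) [ν.IsAddHaarMeasure] (x₀ : E) :
    ∃ (η : ℝ → E → ℝ) (I C : ℝ), 0 < I ∧ 0 ≤ C ∧ ∀ r > 0, ContDiff ℝ ∞ (η r) ∧
      HasCompactSupport (η r) ∧ tsupport (η r) ⊆ ball x₀ r ∧ (∀ x, 0 ≤ η r x) ∧
      ∫ x, η r x ∂ν = r ^ Module.finrank ℝ E * I ∧
      ∀ x v, |fderiv ℝ (η r) x v| ≤ C * r⁻¹ * ‖v‖ := by
  -- Outer radius `1 / 2` puts the closed support of the rescaled bump in the closed ball of radius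
  -- `r / 2`, inside the open ball of radius `r`.
  let ρ : ContDiffBump (0 : E) := ⟨1 / 4, 1 / 2, by norm_num, by norm_num⟩
  have hρ1 : ContDiff ℝ ∞ ρ := ρ.contDiff
  obtain ⟨C, hC⟩ := (ρ.hasCompactSupport.fderiv ℝ).exists_bound_of_continuous
    (hρ1.continuous_fderiv (by simp))
  refine ⟨fun r x => ρ (r⁻¹ • (x - x₀)), ∫ x, ρ x ∂ν, C, ρ.integral_pos,
    (norm_nonneg _).trans (hC 0), fun r hr => ?_⟩
  have hcd : ContDiff ℝ ∞ fun x => ρ (r⁻¹ • (x - x₀)) := by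
    exact hρ1.comp (contDiff_const.smul (contDiff_id.sub contDiff_const))
  have hts : tsupport (fun x => ρ (r⁻¹ • (x - x₀))) ⊆ closedBall x₀ (r / 2) := by
    refine closure_minimal (fun x hx => ?_) isClosed_closedBall
    have h1 : r⁻¹ • (x - x₀) ∈ Function.support ρ := hx
    rw [ρ.support_eq, mem_ball_zero_iff, norm_smul, norm_inv, Real.norm_of_nonneg hr.le] at h1
    change r⁻¹ * ‖x - x₀‖ < 1 / 2 at h1
    rw [mem_closedBall, dist_eq_norm]
    rw [inv_mul_lt_iff₀ hr] at h1
    linarith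
  refine ⟨hcd, (isCompact_closedBall _ _).of_isClosed_subset (isClosed_tsupport _) hts,
    hts.trans (closedBall_subset_ball (by linarith)), fun x => ρ.nonneg, ?_, fun x v => ?_⟩
  · rw [integral_sub_right_eq_self (μ := ν) (fun x => ρ (r⁻¹ • x)) x₀,
      Measure.integral_comp_inv_smul_of_nonneg ν _ hr.le, smul_eq_mul]
  · have h1 : HasFDerivAt (fun x => ρ (r⁻¹ • (x - x₀)))
        ((fderiv ℝ ρ (r⁻¹ • (x - x₀))).comp (r⁻¹ • ContinuousLinearMap.id ℝ E)) x :=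
      (hρ1.differentiable (by simp) _).hasFDerivAt.comp x
        (((hasFDerivAt_id x).sub_const x₀).const_smul r⁻¹)
    rw [h1.fderiv]
    simp only [ContinuousLinearMap.comp_apply, smul_apply,
      ContinuousLinearMap.id_apply, map_smul, smul_eq_mul, abs_mul, abs_inv, abs_of_pos hr]
    have h2 := (fderiv ℝ ρ (r⁻¹ • (x - x₀))).le_of_opNorm_le (hC _) v
    rw [Real.norm_eq_abs] at h2
    calc r⁻¹ * |fderiv ℝ ρ (r⁻¹ • (x - x₀)) v| ≤ r⁻¹ * (C * ‖v‖) := by gcongr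
      _ = _ := by ring

/-- If a continuous function `m` is a distributional divergence-type expression of a continuous
field that vanishes on `B`, then `m` vanishes at the superdensity points of `B`. -/
theorem eq_zero_of_superdensity {W B : Set E} (hW : IsOpen W) {x₀ : E} (hx₀ : x₀ ∈ W)
    {s t m : E → ℝ} (hs : ContinuousOn s W) (ht : ContinuousOn t W) (hm : ContinuousOn m W)
    (hsB : ∀ x ∈ B, s x = 0) (htB : ∀ x ∈ B, t x = 0)
    (hB : (fun r : ℝ => ν.real (ball x₀ r \ B)) =o[𝓝[>] 0]
      fun r : ℝ => r ^ (Module.finrank ℝ E + 1)) (a b : E)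
    (h : ∀ η : E → ℝ, ContDiff ℝ ∞ η → HasCompactSupport η → tsupport η ⊆ W →
      ∫ x, (s x * fderiv ℝ η x b - t x * fderiv ℝ η x a) ∂ν = ∫ x, m x * η x ∂ν) :
    m x₀ = 0 := by
  obtain ⟨η, I, C, hI, hC, hη⟩ := exists_rescaled_bump ν x₀
  set d := Module.finrank ℝ E
  -- Near `x₀` the left integrand is at most `K / r`: continuity bounds `s` and `t`, and the bump
  -- has gradient at most `C / r`.
  set K : ℝ := (|s x₀| + 1) * (C * ‖b‖) + (|t x₀| + 1) * (C * ‖a‖) with hK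
  have hK0 : 0 ≤ K := by positivity
  suffices H : ∀ ε > 0, |m x₀| * I ≤ ε * (I + K) by
    have h0 : |m x₀| * I ≤ 0 := by
      refine le_of_forall_pos_le_add fun ε hε => ?_
      have := H (ε / (I + K)) (by positivity)
      rwa [div_mul_cancel₀ _ (by positivity), ← zero_add ε] at this
    have h1 : |m x₀| ≤ 0 := by
      by_contra hlt
      push Not at hlt
      nlinarith [mul_pos hlt hI]
    exact abs_nonpos_iff.1 h1
  intro ε hε
  have c1 : ∀ᶠ x in 𝓝 x₀, |s x| ≤ |s x₀| + 1 :=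
    ((hs.continuousAt (hW.mem_nhds hx₀)).abs.eventually (gt_mem_nhds (lt_add_one _))).mono
      fun _ h => h.le
  have c2 : ∀ᶠ x in 𝓝 x₀, |t x| ≤ |t x₀| + 1 :=
    ((ht.continuousAt (hW.mem_nhds hx₀)).abs.eventually (gt_mem_nhds (lt_add_one _))).mono
      fun _ h => h.le
  have c3 : ∀ᶠ x in 𝓝 x₀, |m x - m x₀| ≤ ε := by
    have := (hm.continuousAt (hW.mem_nhds hx₀)).eventually (closedBall_mem_nhds _ hε)
    exact this.mono fun x hx => by rwa [← Real.dist_eq]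
  obtain ⟨δ, hδ, hball⟩ := Metric.eventually_nhds_iff_ball.1
    (c1.and (c2.and (c3.and (hW.mem_nhds hx₀))))
  have hB' := hB.def hε
  have hr1 : ∀ᶠ r : ℝ in 𝓝[>] 0, r < δ := nhdsWithin_le_nhds (gt_mem_nhds hδ)
  obtain ⟨r, hrB, hrδ, hr⟩ := (hB'.and (hr1.and self_mem_nhdsWithin)).exists
  have hr : 0 < r := hr
  rw [Real.norm_of_nonneg measureReal_nonneg, Real.norm_of_nonneg (by positivity)] at hrB
  obtain ⟨hη1, hη2, hη3, hη4, hη5, hη6⟩ := hη r hr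
  have hsub : ball x₀ r ⊆ ball x₀ δ := ball_subset_ball hrδ.le
  have hηW : tsupport (η r) ⊆ W := fun x hx => (hball x (hsub (hη3 hx))).2.2.2
  have heq := h (η r) hη1 hη2 hηW
  have hleft : |∫ x, m x * η r x ∂ν| ≤ K * r⁻¹ * ν.real (ball x₀ r \ B) := by
    rw [← heq]
    refine norm_integral_le_mul_measureReal
      ((measure_mono sdiff_subset).trans_lt measure_ball_lt_top).ne (fun x hx => ?_) fun x hx => ?_
    · by_cases hxB : x ∈ B
      · simp [hsB x hxB, htB x hxB]
      · have : x ∉ tsupport (η r) := fun h => hx ⟨hη3 h, hxB⟩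
        simp [fderiv_eq_zero_of_notMem_tsupport this]
    · obtain ⟨b1, b2, -, -⟩ := hball x (hsub hx.1)
      refine (abs_sub _ _).trans ?_
      rw [abs_mul, abs_mul]
      calc |s x| * |fderiv ℝ (η r) x b| + |t x| * |fderiv ℝ (η r) x a|
          ≤ (|s x₀| + 1) * (C * r⁻¹ * ‖b‖) + (|t x₀| + 1) * (C * r⁻¹ * ‖a‖) := by
            gcongr
            · exact hη6 x b
            · exact hη6 x a
        _ = K * r⁻¹ := by rw [hK]; ring
  -- The exponent `d + 1` of the density absorbs the factor `r⁻¹` of the gradient and leaves `r ^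
  -- d`, the order of the mass of the bump, times the small `ε`.
  have hleft' : |∫ x, m x * η r x ∂ν| ≤ ε * K * r ^ d := by
    refine hleft.trans ?_
    calc K * r⁻¹ * ν.real (ball x₀ r \ B) ≤ K * r⁻¹ * (ε * r ^ (d + 1)) := by gcongr
      _ = ε * K * r ^ d := by field_simp; ring
  have hηint : Integrable (η r) ν := hη1.continuous.integrable_of_hasCompactSupport hη2
  have hmint : Integrable (fun x => m x * η r x) ν :=
    ContinuousOn.integrable_mul_of_tsupport_subset hW hm hη1.continuous hη2 hηW
  have hdiff : |∫ x, m x * η r x ∂ν - m x₀ * (r ^ d * I)| ≤ ε * (r ^ d * I) := by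
    rw [← hη5, ← integral_const_mul, ← integral_sub hmint (hηint.const_mul _),
      ← integral_const_mul]
    rw [← Real.norm_eq_abs]
    refine norm_integral_le_of_norm_le (hηint.const_mul _) (Eventually.of_forall fun x => ?_)
    rw [← sub_mul, Real.norm_eq_abs, abs_mul, abs_of_nonneg (hη4 x)]
    by_cases hx : x ∈ tsupport (η r)
    · exact mul_le_mul_of_nonneg_right (hball x (hsub (hη3 hx))).2.2.1 (hη4 x)
    · simp [image_eq_zero_of_notMem_tsupport hx]
  have hrd : 0 < r ^ d := by positivity
  have hfin : |m x₀ * (r ^ d * I)| ≤ ε * K * r ^ d + ε * (r ^ d * I) := by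
    have h1 : m x₀ * (r ^ d * I) =
      ∫ x, m x * η r x ∂ν - (∫ x, m x * η r x ∂ν - m x₀ * (r ^ d * I)) := by ring
    rw [h1]
    exact (abs_sub _ _).trans (add_le_add hleft' hdiff)
  rw [abs_mul, abs_of_pos (show 0 < r ^ d * I by positivity)] at hfin
  refine le_of_mul_le_mul_right ?_ hrd
  linarith

/-- Superdensity is invariant under `C¹` diffeomorphisms. -/
theorem isLittleO_measure_ball_diff_of_local_inverse {m : ℝ} {S T : E → E} {x₀ : E}
    (hS : DifferentiableAt ℝ S x₀) (hT : ContDiffAt ℝ 1 T (S x₀)) {B B' : Set E}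
    (hTS : ∀ᶠ x in 𝓝 x₀, T (S x) = x) (hBB' : ∀ᶠ x in 𝓝 x₀, x ∉ B → S x ∉ B')
    (h : (fun r : ℝ => ν.real (ball (S x₀) r \ B')) =o[𝓝[>] 0] fun r : ℝ => r ^ m) :
    (fun r : ℝ => ν.real (ball x₀ r \ B)) =o[𝓝[>] 0] fun r : ℝ => r ^ m := by
  have hT' := hT.hasStrictFDerivAt one_ne_zero
  set A := fderiv ℝ T (S x₀)
  -- For any `c > |det A|`, a map close enough to its derivative `A` multiplies the outer measure of
  -- arbitrary sets by at most `c`.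
  obtain ⟨c, hc⟩ := ENNReal.lt_iff_exists_nnreal_btwn.1
    (ENNReal.ofReal_lt_top (r := |A.det|))
  have hev := (addHaar_image_le_mul_of_det_lt ν A hc.1).and self_mem_nhdsWithin
  obtain ⟨δ, hδ, hδ0⟩ := hev.exists
  obtain ⟨V, hV, hVA⟩ := hT'.approximates_deriv_on_nhds (c := δ) (Or.inr hδ0)
  obtain ⟨K, hK, hSK⟩ := hS.isBigO_sub.exists_pos
  rw [Asymptotics.IsBigOWith] at hSK
  obtain ⟨ε, hε, hεV⟩ := Metric.mem_nhds_iff.1 hV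
  obtain ⟨r₀, hr₀, hball⟩ := Metric.eventually_nhds_iff_ball.1 (hTS.and (hBB'.and hSK))
  have hscale : Tendsto (fun r : ℝ => (K + 1) * r) (𝓝[>] 0) (𝓝[>] 0) := by
    refine tendsto_nhdsWithin_iff.2 ⟨?_, ?_⟩
    · have : Tendsto (fun r : ℝ => (K + 1) * r) (𝓝 0) (𝓝 ((K + 1) * 0)) :=
        (continuous_const.mul continuous_id).tendsto 0
      rw [mul_zero] at this
      exact this.mono_left nhdsWithin_le_nhds
    · filter_upwards [self_mem_nhdsWithin] with r hr
      have : 0 < r := hr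
      exact mem_Ioi.2 (by positivity)
  have h1 := h.comp_tendsto hscale
  have h2 : (fun r : ℝ => ν.real (ball x₀ r \ B)) =O[𝓝[>] 0]
      ((fun r : ℝ => ν.real (ball (S x₀) r \ B')) ∘ fun r => (K + 1) * r) := by
    refine Asymptotics.IsBigO.of_bound c ?_
    have e1 : ∀ᶠ r : ℝ in 𝓝[>] 0, r < r₀ := nhdsWithin_le_nhds (gt_mem_nhds hr₀)
    have e2 : ∀ᶠ r : ℝ in 𝓝[>] 0, (K + 1) * r < ε :=
      hscale.eventually (nhdsWithin_le_nhds (gt_mem_nhds hε))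
    filter_upwards [e1, e2, self_mem_nhdsWithin] with r hr1 hr2 hr
    have hr : 0 < r := hr
    rw [Function.comp_apply, Real.norm_of_nonneg measureReal_nonneg,
      Real.norm_of_nonneg measureReal_nonneg]
    have hfin : ν (ball (S x₀) ((K + 1) * r) \ B') ≠ ⊤ :=
      ((measure_mono sdiff_subset).trans_lt measure_ball_lt_top).ne
    -- Each `x` is `T (S x)`, and differentiability of `S` at `x₀` keeps `S x` in a ball of
    -- comparable radius.
    have hincl : ball x₀ r \ B ⊆ T '' (ball (S x₀) ((K + 1) * r) \ B') := by
      rintro x ⟨hx, hxB⟩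
      obtain ⟨p1, p2, p3⟩ := hball x (ball_subset_ball hr1.le hx)
      refine ⟨S x, ⟨?_, p2 hxB⟩, p1⟩
      rw [mem_ball, dist_eq_norm] at hx ⊢
      calc ‖S x - S x₀‖ ≤ K * ‖x - x₀‖ := p3
        _ ≤ K * r := by gcongr
        _ < (K + 1) * r := by linarith
    have happ : ApproximatesLinearOn T A (ball (S x₀) ((K + 1) * r) \ B') δ :=
      hVA.mono_set (sdiff_subset.trans ((ball_subset_ball hr2.le).trans hεV))
    have hle := (measure_mono hincl).trans (hδ _ _ happ)
    have := ENNReal.toReal_mono (ENNReal.mul_ne_top ENNReal.coe_ne_top hfin) hle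
    simpa [measureReal_def] using this
  refine (h2.trans_isLittleO h1).trans_isBigO ?_
  refine Asymptotics.IsBigO.of_bound ((K + 1) ^ m) ?_
  filter_upwards [self_mem_nhdsWithin] with r hr
  have hr : 0 < r := hr
  simp only [Function.comp_apply]
  rw [Real.mul_rpow (by positivity) hr.le, norm_mul,
    Real.norm_of_nonneg (show 0 ≤ (K + 1) ^ m by positivity)]

end BlowUp

/-! ### Linearity rules for wedge products and top coefficients. -/

section WedgeBasics

theorem wedge_zero {V : Type*} [AddCommGroup V] [Module ℝ V] [TopologicalSpace V] {p q : ℕ}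
    (a : V [⋀^Fin p]→L[ℝ] ℝ) : wedge a (0 : V [⋀^Fin q]→L[ℝ] ℝ) = 0 := by
  ext v
  rw [wedge_apply]
  simp

theorem wedge_smul {V : Type*} [AddCommGroup V] [Module ℝ V] [TopologicalSpace V] {p q : ℕ}
    (a : V [⋀^Fin p]→L[ℝ] ℝ) (c : ℝ) (b : V [⋀^Fin q]→L[ℝ] ℝ) :
    wedge a (c • b) = c • wedge a b := by
  ext v
  rw [ContinuousAlternatingMap.smul_apply, wedge_apply, wedge_apply, smul_eq_mul, mul_left_comm,
    Finset.mul_sum _ _ c]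
  simp only [ContinuousAlternatingMap.smul_apply, smul_eq_mul, mul_smul_comm, mul_left_comm _ c]

theorem topCoeff_smul {M n : ℕ} (h : n = M) (c : ℝ) (a : Euc M [⋀^Fin n]→L[ℝ] ℝ) :
    topCoeff h (c • a) = c * topCoeff h a := rfl

theorem topCoeff_matWedge {M L p q : ℕ} (h : p + q = M)
    (A : Matrix (Fin L) (Fin L) (Euc M [⋀^Fin p]→L[ℝ] ℝ))
    (B : Matrix (Fin L) (Fin L) (Euc M [⋀^Fin q]→L[ℝ] ℝ)) (i j : Fin L) :
    topCoeff h (matWedge A B i j) = ∑ k, topCoeff h (wedge (A i k) (B k j)) := by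
  simp only [topCoeff, matWedge, ContinuousAlternatingMap.sum_apply]

theorem topCoeff_zero {M n : ℕ} (h : n = M) :
    topCoeff h (0 : Euc M [⋀^Fin n]→L[ℝ] ℝ) = 0 := rfl

end WedgeBasics

/-! ### The distributional derivative and the Maurer–Cartan form in a chart. -/

section Charts

variable {X : Type*} [TopologicalSpace X] {L : ℕ}

/-- The defining property of the distributional exterior derivative of a matrix of `1`-forms,
tested against `η` times a constant form in the entry `(j, j)`. -/
theorem MatForm.IsDED.integral_inChart {q : ℕ} [ChartedSpace (Euc (q + 2)) X]
    {φ : MatForm 𝓘(ℝ, Euc (q + 2)) X L 1} {δφ : MatForm 𝓘(ℝ, Euc (q + 2)) X L (1 + 1)}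
    (hded : MatForm.IsDED φ δφ) {e : OpenPartialHomeomorph X (Euc (q + 2))}
    (he : e ∈ IsManifold.maximalAtlas 𝓘(ℝ, Euc (q + 2)) 2 X) {η : Euc (q + 2) → ℝ}
    (hη : ContDiff ℝ 2 η) (hηc : HasCompactSupport η) (hηe : tsupport η ⊆ e.target)
    (i j : Fin L) (a b : Euc (q + 2)) :
    ∫ x, (MatForm.inChart e φ x i j ![a] * fderiv ℝ η x b -
        MatForm.inChart e φ x i j ![b] * fderiv ℝ η x a) =
      ∫ x, MatForm.inChart e δφ x i j ![a, b] * η x := by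
  classical
  set κ := contractedDet q a b
  have h1 : 1 + (q + 1) = q + 2 := by omega
  have h2 : 1 + 1 + q = q + 2 := by omega
  have hsub : tsupport (fun x => η x • κ) ⊆ tsupport η :=
    closure_mono (Function.support_smul_subset_left η _)
  -- Row `j` of the test matrix is `η κ` in every column and the other rows vanish. The `(i, j)`
  -- entry of a product reads only column `j` of it, so exactly the term with `φ^{ij}`, respectively
  -- `δφ^{ij}`, survives.
  have h := hded e he q h2
    (fun k _ => if k = j then (fun x => η x • κ) else 0) (fun k l => by
      split_ifs
      · exact ⟨hη.smul contDiff_const, hηc.smul_right, hsub.trans hηe⟩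
      · exact ⟨contDiff_const, HasCompactSupport.zero, by simp [tsupport]⟩) i j
  have hl : ∀ x, topCoeff h1 (matWedge (MatForm.inChart e φ x) (fun k _ =>
      extDeriv (if k = j then (fun x => η x • κ) else 0) x) i j) =
      MatForm.inChart e φ x i j ![a] * fderiv ℝ η x b -
        MatForm.inChart e φ x i j ![b] * fderiv ℝ η x a := by
    intro x
    refine (topCoeff_matWedge h1 _ _ i j).trans ((Finset.sum_eq_single j ?_ ?_).trans ?_)
    · intro k _ hk
      have h0 : extDeriv (0 : Euc (q + 2) → Euc (q + 2) [⋀^Fin q]→L[ℝ] ℝ) x = 0 := by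
        simpa using extDeriv_smul (0 : ℝ)
          (0 : Euc (q + 2) → Euc (q + 2) [⋀^Fin q]→L[ℝ] ℝ) (x := x)
      rw [if_neg hk, h0, wedge_zero, topCoeff_zero]
    · simp
    · rw [if_pos rfl, topCoeff_wedge_extDeriv h1 _ η x (hη.differentiable two_ne_zero x)]
  have hr : ∀ x, topCoeff h2 (matWedge (MatForm.inChart e δφ x) (fun k _ =>
      (if k = j then (fun x => η x • κ) else 0 :
        Euc (q + 2) → Euc (q + 2) [⋀^Fin q]→L[ℝ] ℝ) x) i j) =
      MatForm.inChart e δφ x i j ![a, b] * η x := by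
    intro x
    refine (topCoeff_matWedge h2 _ _ i j).trans ((Finset.sum_eq_single j ?_ ?_).trans ?_)
    · intro k _ hk
      rw [if_neg hk, Pi.zero_apply, wedge_zero, topCoeff_zero]
    · simp
    · rw [if_pos rfl, wedge_smul, topCoeff_smul, topCoeff_wedge_contractedDet h2, mul_comm]
  rw [show (-1 : ℝ) ^ (1 + 1) = 1 by norm_num, one_mul] at h
  have h' : ∫ x in e.target, (MatForm.inChart e φ x i j ![a] * fderiv ℝ η x b -
        MatForm.inChart e φ x i j ![b] * fderiv ℝ η x a) =
      ∫ x in e.target, MatForm.inChart e δφ x i j ![a, b] * η x := by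
    simpa only [hl, hr] using h
  rwa [setIntegral_eq_integral_of_forall_compl_eq_zero,
    setIntegral_eq_integral_of_forall_compl_eq_zero] at h'
  · intro x hx
    simp [image_eq_zero_of_notMem_tsupport fun h => hx (hηe h)]
  · intro x hx
    simp [fderiv_eq_zero_of_notMem_tsupport fun h => hx (hηe h)]

theorem glForm_apply (z : MatSpace L) (i j : Fin L) (w : Fin 1 → MatSpace L) :
    (glForm L z i j : MatSpace L [⋀^Fin 1]→L[ℝ] ℝ) w =
      ∑ k, ((Matrix.of z)⁻¹ : Matrix (Fin L) (Fin L) ℝ) i k * w 0 k j := by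
  change (∑ k, ((Matrix.of z)⁻¹ : Matrix (Fin L) (Fin L) ℝ) i k • dz k j :
    MatSpace L [⋀^Fin 1]→L[ℝ] ℝ) w = _
  rw [ContinuousAlternatingMap.sum_apply]
  rfl

/-- Pullback of the Maurer–Cartan form in a chart. -/
theorem inChart_pullback_maurerCartan {M n : ℕ} [ChartedSpace (Euc M) X]
    {G : Type*} [TopologicalSpace G] [ChartedSpace (Euc n) G] [Group G]
    (ι : G →* GL (Fin L) ℝ) {f : X → G} {e : OpenPartialHomeomorph X (Euc M)} {x : Euc M}
    (he : MDifferentiableAt 𝓘(ℝ, Euc M) 𝓘(ℝ, Euc M) e.symm x)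
    (hf : MDifferentiableAt 𝓘(ℝ, Euc M) 𝓘(ℝ, Euc n) f (e.symm x))
    (hι : MDifferentiableAt 𝓘(ℝ, Euc n) 𝓘(ℝ, MatSpace L) (coords ι) (f (e.symm x)))
    (i j : Fin L) (v : Euc M) :
    MatForm.inChart e (MatForm.pullback f (maurerCartan (n := n) ι)) x i j ![v] =
      ∑ k, coords ι (f (e.symm x))⁻¹ i k *
        fderiv ℝ (fun y => coords ι (f (e.symm y)) k j) x v := by
  have hc : mfderiv 𝓘(ℝ, Euc M) 𝓘(ℝ, MatSpace L) (coords ι ∘ f ∘ e.symm) x =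
      (mfderiv 𝓘(ℝ, Euc n) 𝓘(ℝ, MatSpace L) (coords ι) (f (e.symm x))).comp
        ((mfderiv 𝓘(ℝ, Euc M) 𝓘(ℝ, Euc n) f (e.symm x)).comp
          (mfderiv 𝓘(ℝ, Euc M) 𝓘(ℝ, Euc M) e.symm x)) := by
    rw [mfderiv_comp x (by exact hι) (hf.comp x he), mfderiv_comp x hf he]
    rfl
  have hd : DifferentiableAt ℝ (coords ι ∘ f ∘ e.symm) x :=
    mdifferentiableAt_iff_differentiableAt.1 (MDifferentiableAt.comp x hι (hf.comp x he))
  have hk : ∀ k, fderiv ℝ (fun y => coords ι (f (e.symm y)) k j) x v =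
      fderiv ℝ (coords ι ∘ f ∘ e.symm) x v k j := by
    intro k
    have h1 := hasFDerivAt_pi'.1 (hasFDerivAt_pi'.1 hd.hasFDerivAt k) j
    exact congrArg (fun T => T v) h1.fderiv
  have hinv : ∀ g : G, (Matrix.of (coords ι g))⁻¹ = Matrix.of (coords ι g⁻¹) := by
    intro g
    have h1 : Matrix.of (coords ι g) = (ι g : Matrix (Fin L) (Fin L) ℝ) := rfl
    have h2 : Matrix.of (coords ι g⁻¹) = ((ι g⁻¹ : GL (Fin L) ℝ) : Matrix (Fin L) (Fin L) ℝ) := rfl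
    rw [h1, h2, map_inv, Matrix.coe_units_inv]
  have hv : mfderiv 𝓘(ℝ, Euc n) 𝓘(ℝ, MatSpace L) (coords ι) (f (e.symm x))
      (mfderiv 𝓘(ℝ, Euc M) 𝓘(ℝ, Euc n) f (e.symm x)
        (mfderiv 𝓘(ℝ, Euc M) 𝓘(ℝ, Euc M) e.symm x v)) =
      fderiv ℝ (coords ι ∘ f ∘ e.symm) x v := by
    rw [← mfderiv_eq_fderiv, hc]
    rfl
  calc MatForm.inChart e (MatForm.pullback f (maurerCartan (n := n) ι)) x i j ![v]
      = glForm L (coords ι (f (e.symm x))) i j (fun _ =>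
          fderiv ℝ (coords ι ∘ f ∘ e.symm) x v) := by
        rw [← hv]
        change glForm L (coords ι (f (e.symm x))) i j _ = glForm L (coords ι (f (e.symm x))) i j _
        congr 1
        funext s
        fin_cases s
        rfl
    _ = _ := by
        rw [glForm_apply, hinv]
        simp only [hk]
        rfl

end Charts

/-! ### Independence of superdensity from the chart. -/

section Main

variable {M L n : ℕ}
    {X : Type*} [TopologicalSpace X] [ChartedSpace (Euc M) X] [IsManifold 𝓘(ℝ, Euc M) 2 X]

/-- Density points may be tested in any `C¹` chart. -/
theorem IsDensityPoint.isLittleO_of_mem_maximalAtlas {m : ℝ} {A : Set X} {Q : X}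
    (hQ : IsDensityPoint (M := M) m A Q) {e : OpenPartialHomeomorph X (Euc M)}
    (he : e ∈ IsManifold.maximalAtlas 𝓘(ℝ, Euc M) 1 X) (hQe : Q ∈ e.source) :
    (fun r : ℝ => volume.real (Metric.ball (e Q) r \ (e.target ∩ e.symm ⁻¹' A)))
      =o[𝓝[>] 0] fun r : ℝ => r ^ m := by
  have : IsManifold 𝓘(ℝ, Euc M) 1 X := IsManifold.of_le (n := 2) one_le_two
  obtain ⟨e', he', hQe', h⟩ := hQ
  have hx0 : e.symm (e Q) = Q := e.left_inv hQe
  have hx0t : e Q ∈ e.target := e.map_source hQe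
  have hS : ContDiffAt ℝ 1 (e' ∘ e.symm) (e Q) := by
    refine ContMDiffAt.contDiffAt (ContMDiffAt.comp (I' := 𝓘(ℝ, Euc M)) (e Q) ?_
      (contMDiffAt_symm_of_mem_maximalAtlas he hx0t))
    rw [hx0]
    exact contMDiffAt_of_mem_maximalAtlas he' hQe'
  have hS0 : (e' ∘ e.symm) (e Q) = e' Q := by simp [hx0]
  have hT : ContDiffAt ℝ 1 (e ∘ e'.symm) ((e' ∘ e.symm) (e Q)) := by
    rw [hS0]
    refine ContMDiffAt.contDiffAt (ContMDiffAt.comp (I' := 𝓘(ℝ, Euc M)) (e' Q) ?_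
      (contMDiffAt_symm_of_mem_maximalAtlas he' (e'.map_source hQe')))
    rw [e'.left_inv hQe']
    exact contMDiffAt_of_mem_maximalAtlas he hQe
  have hnear : ∀ᶠ x in 𝓝 (e Q), x ∈ e.target ∧ e.symm x ∈ e'.source := by
    refine Eventually.and (e.open_target.mem_nhds hx0t)
      ((e.continuousAt_symm hx0t).eventually (e'.open_source.mem_nhds ?_))
    rwa [hx0]
  -- The transition map and its inverse play `S` and `T`; injectivity of `e'` on its source sends
  -- the complement of `A` to the complement of its image.
  refine isLittleO_measure_ball_diff_of_local_inverse (hS.differentiableAt one_ne_zero) hT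
    (B' := e' '' (A ∩ e'.source)) ?_ ?_ ?_
  · filter_upwards [hnear] with x hx
    simp [e'.left_inv hx.2, e.right_inv hx.1]
  · filter_upwards [hnear] with x hx hxB
    rintro ⟨P, ⟨hPA, hPs⟩, hP⟩
    have : P = e.symm x := e'.injOn hPs hx.2 hP
    exact hxB ⟨hx.1, by rwa [mem_preimage, ← this]⟩
  · rw [hS0]
    exact h

end Main

/-! ### The structure equation at a superdensity point. -/

section StructureEquation

/-- Otherwise small balls miss `B`, and their measure `c r^d` is not `o(r^(d+1))`. A density point
need not belong to the set, so this is what transfers continuous identities to it. -/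
theorem mem_closure_of_superdensity {E : Type*} [NormedAddCommGroup E] [NormedSpace ℝ E]
    [FiniteDimensional ℝ E] [MeasurableSpace E] [BorelSpace E] {ν : Measure E}
    [ν.IsAddHaarMeasure] {B : Set E} {x₀ : E}
    (hB : (fun r : ℝ => ν.real (Metric.ball x₀ r \ B)) =o[𝓝[>] 0]
      fun r : ℝ => r ^ (Module.finrank ℝ E + 1)) : x₀ ∈ closure B := by
  by_contra hx
  obtain ⟨δ, hδ, hball⟩ := Metric.mem_nhds_iff.1 (isClosed_closure.isOpen_compl.mem_nhds hx)
  set d := Module.finrank ℝ E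
  set c := ν.real (Metric.ball (0 : E) 1)
  have hc : 0 < c := ENNReal.toReal_pos (Metric.measure_ball_pos ν 0 one_pos).ne'
    measure_ball_lt_top.ne
  have e1 : ∀ᶠ r : ℝ in 𝓝[>] 0, r < δ := nhdsWithin_le_nhds (gt_mem_nhds hδ)
  have e2 : ∀ᶠ r : ℝ in 𝓝[>] 0, r < 1 := nhdsWithin_le_nhds (gt_mem_nhds one_pos)
  obtain ⟨r, ⟨hr1, hr2, hrB⟩, hr⟩ := ((e1.and (e2.and (hB.def (half_pos hc)))).and
    self_mem_nhdsWithin).exists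
  have hr : 0 < r := hr
  have hdiff : Metric.ball x₀ r \ B = Metric.ball x₀ r := by
    refine sdiff_eq_left.2 (disjoint_left.2 fun y hy hyB => ?_)
    exact hball (Metric.ball_subset_ball hr1.le hy) (subset_closure hyB)
  rw [hdiff, Real.norm_of_nonneg measureReal_nonneg, Real.norm_of_nonneg (by positivity),
    measureReal_def, Measure.addHaar_ball_of_pos ν x₀ hr, ENNReal.toReal_mul,
    ENNReal.toReal_ofReal (by positivity)] at hrB
  change r ^ d * c ≤ c / 2 * r ^ (d + 1) at hrB
  have hrd : 0 < r ^ d * c := by positivity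
  have : c / 2 * r ^ (d + 1) = (r ^ d * c) * (r / 2) := by ring
  nlinarith

/-- The structure equation at a superdensity point, in a chart. -/
theorem inChart_structure_equation {q L n : ℕ}
    {X : Type*} [TopologicalSpace X] [ChartedSpace (Euc (q + 2)) X]
    [IsManifold 𝓘(ℝ, Euc (q + 2)) 2 X]
    {G : Type*} [TopologicalSpace G] [ChartedSpace (Euc n) G] [Group G]
    [LieGroup 𝓘(ℝ, Euc n) ∞ G]
    {ι : G →* GL (Fin L) ℝ} (hι : IsLieSubgroupInclusion (n := n) ι)
    {φ : MatForm 𝓘(ℝ, Euc (q + 2)) X L 1} (hφ : MatForm.IsC0 φ)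
    {δφ : MatForm 𝓘(ℝ, Euc (q + 2)) X L (1 + 1)} (hδφ : MatForm.IsC0 δφ)
    (hded : MatForm.IsDED φ δφ) {U : Set X} (hU : IsOpen U)
    {f : X → G} (hf : ContMDiffOn 𝓘(ℝ, Euc (q + 2)) 𝓘(ℝ, Euc n) 1 f U)
    {Q : X} (hQU : Q ∈ U)
    (hQ : IsDensityPoint (M := q + 2) (((q + 2 : ℕ) : ℝ) + 1)
      {P ∈ U | MatForm.pullback f (maurerCartan (n := n) ι) P = φ P} Q)
    {e : OpenPartialHomeomorph X (Euc (q + 2))}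
    (he : e ∈ IsManifold.maximalAtlas 𝓘(ℝ, Euc (q + 2)) 2 X)
    (he1 : e ∈ IsManifold.maximalAtlas 𝓘(ℝ, Euc (q + 2)) 1 X) (hQe : Q ∈ e.source)
    (i j : Fin L) (a b : Euc (q + 2)) :
    MatForm.inChart e δφ (e Q) i j ![a, b] =
      -∑ k, (MatForm.inChart e φ (e Q) i k ![a] * MatForm.inChart e φ (e Q) k j ![b] -
        MatForm.inChart e φ (e Q) i k ![b] * MatForm.inChart e φ (e Q) k j ![a]) := by
  have : IsManifold 𝓘(ℝ, Euc (q + 2)) 1 X := IsManifold.of_le (n := 2) one_le_two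
  set A : Set X := {P ∈ U | MatForm.pullback f (maurerCartan (n := n) ι) P = φ P} with hA
  set W : Set (Euc (q + 2)) := e.target ∩ e.symm ⁻¹' U with hWdef
  have hW : IsOpen W := e.isOpen_inter_preimage_symm hU
  have hWe : W ⊆ e.target := inter_subset_left
  have hx0 : e Q ∈ W := ⟨e.map_source hQe, by rwa [mem_preimage, e.left_inv hQe]⟩
  have hmap : ContMDiffOn 𝓘(ℝ, Euc (q + 2)) 𝓘(ℝ, Euc n) 1 (fun x => f (e.symm x)) W :=
    hf.comp ((contMDiffOn_symm_of_mem_maximalAtlas he1).mono hWe) fun x hx => hx.2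
  have hι1 : ContMDiff 𝓘(ℝ, Euc n) 𝓘(ℝ, MatSpace L) 1 (coords ι) :=
    hι.smooth.of_le (by exact_mod_cast le_top)
  have hinv : ContMDiff 𝓘(ℝ, Euc n) 𝓘(ℝ, Euc n) 1 (fun g : G => g⁻¹) :=
    (contMDiff_inv 𝓘(ℝ, Euc n) ∞).of_le (by exact_mod_cast le_top)
  set g : Euc (q + 2) → Fin L → Fin L → ℝ := fun x => coords ι (f (e.symm x)) with hg
  -- The inverse matrix is obtained from inversion in `G`: it is C¹ because inversion is smooth, and
  -- inverse to `g` because `ι` is a homomorphism.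
  set h : Euc (q + 2) → Fin L → Fin L → ℝ := fun x => coords ι (f (e.symm x))⁻¹ with hh
  have hg1 : ContDiffOn ℝ 1 g W := (hι1.comp_contMDiffOn hmap).contDiffOn
  have hh1 : ContDiffOn ℝ 1 h W := ((hι1.comp hinv).comp_contMDiffOn hmap).contDiffOn
  have hg2 : ∀ k l, ContDiffOn ℝ 1 (fun x => g x k l) W := fun k l =>
    contDiffOn_pi.1 (contDiffOn_pi.1 hg1 k) l
  have hh2 : ∀ k l, ContDiffOn ℝ 1 (fun x => h x k l) W := fun k l =>
    contDiffOn_pi.1 (contDiffOn_pi.1 hh1 k) l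
  have hmul : ∀ s t : G, s * t = 1 → ∀ k l, ∑ m, coords ι s k m * coords ι t m l =
      if k = l then 1 else 0 := by
    intro s t hst k l
    have h1 : (ι s : Matrix (Fin L) (Fin L) ℝ) * (ι t : Matrix (Fin L) (Fin L) ℝ) = 1 := by
      rw [← Units.val_mul, ← map_mul, hst, map_one, Units.val_one]
    have h2 := congrFun (congrFun h1 k) l
    rwa [Matrix.mul_apply, Matrix.one_apply] at h2
  set θ : Fin L → Fin L → Euc (q + 2) → Euc (q + 2) → ℝ := fun k l x v =>
    ∑ m, h x k m * fderiv ℝ (fun y => g y m l) x v with hθ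
  have hθc : ∀ k l v, ContinuousOn (fun x => θ k l x v) W := fun k l v =>
    continuousOn_finsetSum _ fun m _ =>
      (hh2 k m).continuousOn.mul ((hg2 m l).continuousOn_fderiv_apply hW v)
  have hφc : ∀ k l v, ContinuousOn (fun x => MatForm.inChart e φ x k l ![v]) W := fun k l v =>
    (ContinuousEvalConst.continuous_eval_const
      (F := Euc (q + 2) [⋀^Fin 1]→L[ℝ] ℝ) ![v]).comp_continuousOn ((hφ e he k l).mono hWe)
  have hδc : ContinuousOn (fun x => MatForm.inChart e δφ x i j ![a, b]) W :=
    (ContinuousEvalConst.continuous_eval_const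
      (F := Euc (q + 2) [⋀^Fin (1 + 1)]→L[ℝ] ℝ) ![a, b]).comp_continuousOn
      ((hδφ e he i j).mono hWe)
  have hAeq : ∀ x ∈ e.target ∩ e.symm ⁻¹' A, ∀ k l v,
      MatForm.inChart e φ x k l ![v] = θ k l x v := by
    rintro x ⟨hx, hxA⟩ k l v
    have hxU : e.symm x ∈ U := hxA.1
    have h1 : MatForm.inChart e φ x =
        MatForm.inChart e (MatForm.pullback f (maurerCartan (n := n) ι)) x := by
      simp only [MatForm.inChart]
      funext k l
      rw [MatForm.pullback, MatForm.pullback, hxA.2]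
    rw [h1]
    exact inChart_pullback_maurerCartan ι
      ((contMDiffAt_symm_of_mem_maximalAtlas he1 hx).mdifferentiableAt one_ne_zero)
      ((hf.contMDiffAt (hU.mem_nhds hxU)).mdifferentiableAt one_ne_zero)
      (hι1.mdifferentiableAt one_ne_zero) k l v
  have hdens : (fun r : ℝ => volume.real (Metric.ball (e Q) r \ (e.target ∩ e.symm ⁻¹' A)))
      =o[𝓝[>] 0] fun r : ℝ => r ^ (Module.finrank ℝ (Euc (q + 2)) + 1) := by
    have h1 := hQ.isLittleO_of_mem_maximalAtlas he1 hQe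
    have h2 : ∀ r : ℝ, r ^ (((q + 2 : ℕ) : ℝ) + 1) =
        r ^ (Module.finrank ℝ (Euc (q + 2)) + 1) := by
      intro r
      rw [finrank_euclideanSpace_fin, ← Real.rpow_natCast]
      push_cast
      rfl
    simpa only [h2] using h1
  have hθ0 : ∀ k l v, θ k l (e Q) v = MatForm.inChart e φ (e Q) k l ![v] := by
    intro k l v
    have hfr := mem_closure_iff_frequently.1 (mem_closure_of_superdensity hdens)
    exact tendsto_nhds_unique_of_frequently_eq ((hθc k l v).continuousAt (hW.mem_nhds hx0))
      ((hφc k l v).continuousAt (hW.mem_nhds hx0)) (hfr.mono fun x hx => (hAeq x hx k l v).symm)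
  -- The field is `φ - θ`, zero on the coincidence set; subtracting the distributional identities
  -- for `φ` and `θ` gives the density `δφ + θ ∧ θ`.
  have hzero := eq_zero_of_superdensity (ν := volume) hW hx0
    (s := fun x => MatForm.inChart e φ x i j ![a] - θ i j x a)
    (t := fun x => MatForm.inChart e φ x i j ![b] - θ i j x b)
    (m := fun x => MatForm.inChart e δφ x i j ![a, b] +
      ∑ k, (θ i k x a * θ k j x b - θ i k x b * θ k j x a))
    ((hφc i j a).sub (hθc i j a)) ((hφc i j b).sub (hθc i j b))
    (hδc.add (continuousOn_finsetSum _ fun k _ =>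
      ((hθc i k a).mul (hθc k j b)).sub ((hθc i k b).mul (hθc k j a))))
    (fun x hx => by rw [hAeq x hx, sub_self]) (fun x hx => by rw [hAeq x hx, sub_self])
    hdens a b fun η hη hηc hηW => by
      have hη1 : ContDiff ℝ 1 η := hη.of_le (by exact_mod_cast le_top)
      have hη2 : ContDiff ℝ 2 η := by exact_mod_cast contDiff_infty.1 hη 2
      have e1 := hded.integral_inChart he hη2 hηc (hηW.trans hWe) i j a b
      have e2 := integral_maurerCartan (ν := (volume : Measure (Euc (q + 2)))) hW hg2 hh2
        (fun x _ => hmul _ _ (mul_inv_cancel _)) (fun x _ => hmul _ _ (inv_mul_cancel _))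
        (θ := θ) (fun _ _ _ _ _ => rfl) hη1 hηc hηW i j a b
      have hd : ∀ u : Euc (q + 2) → ℝ, ContinuousOn u W → ∀ v,
          Integrable (fun x => u x * fderiv ℝ η x v) := fun u hu v =>
        ContinuousOn.integrable_mul_of_tsupport_subset hW hu
          ((hη1.continuous_fderiv one_ne_zero).clm_apply continuous_const)
          (hηc.fderiv_apply ℝ v) ((tsupport_fderiv_apply_subset ℝ v).trans hηW)
      have i1 := (hd _ (hφc i j a) b).sub (hd _ (hφc i j b) a)
      have i2 := (hd _ (hθc i j a) b).sub (hd _ (hθc i j b) a)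
      have i3 : Integrable (fun x => MatForm.inChart e δφ x i j ![a, b] * η x) :=
        ContinuousOn.integrable_mul_of_tsupport_subset hW hδc hη1.continuous hηc hηW
      have i4 : Integrable (fun x =>
          -(∑ k, (θ i k x a * θ k j x b - θ i k x b * θ k j x a)) * η x) :=
        ContinuousOn.integrable_mul_of_tsupport_subset hW
          (continuousOn_finsetSum _ fun k _ =>
            ((hθc i k a).mul (hθc k j b)).sub ((hθc i k b).mul (hθc k j a))).neg
          hη1.continuous hηc hηW
      have e3 := integral_sub i1 i2
      have e4 := integral_sub i3 i4
      simp only [Pi.sub_apply] at e3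
      rw [e1, e2, ← e4] at e3
      refine (integral_congr_ae (Eventually.of_forall fun x => ?_)).trans
        (e3.trans (integral_congr_ae (Eventually.of_forall fun x => ?_)))
      · beta_reduce
        ring
      · beta_reduce
        ring
  simp only [hθ0] at hzero
  linarith

end StructureEquation

end

theorem theorem5p2 {M L n : ℕ}
    {X : Type*} [TopologicalSpace X] [ChartedSpace (Euc M) X] [IsManifold 𝓘(ℝ, Euc M) 2 X]
    {G : Type*} [TopologicalSpace G] [ChartedSpace (Euc n) G] [Group G]
    [LieGroup 𝓘(ℝ, Euc n) ∞ G]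
    (ι : G →* GL (Fin L) ℝ) (hι : IsLieSubgroupInclusion (n := n) ι)
    (φ : MatForm 𝓘(ℝ, Euc M) X L 1) (hφ : MatForm.IsC0 φ)
    (δφ : MatForm 𝓘(ℝ, Euc M) X L (1 + 1)) (hδφ : MatForm.IsC0 δφ) (hded : MatForm.IsDED φ δφ)
    (U : Set X) (hU : IsOpen U)
    (f : X → G) (hf : ContMDiffOn 𝓘(ℝ, Euc M) 𝓘(ℝ, Euc n) 1 f U)
    (Q : X) (hQU : Q ∈ U)
    (hQ : IsDensityPoint (M := M) ((M : ℝ) + 1)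
      {P ∈ U | MatForm.pullback f (maurerCartan (n := n) ι) P = φ P} Q) :
    δφ Q = -matWedge (φ Q) (φ Q) := by
  have : IsManifold 𝓘(ℝ, Euc M) 1 X := IsManifold.of_le (n := 2) one_le_two
  -- In dimension at most one every 2-form is zero.
  rcases lt_or_ge M 2 with hM | hM
  · have hz : ∀ c d : Euc M [⋀^Fin (1 + 1)]→L[ℝ] ℝ, c = d := fun c d => by
      rw [c.eq_zero_of_finrank_lt (by simpa using hM), d.eq_zero_of_finrank_lt (by simpa using hM)]
    funext i j
    exact hz _ _
  obtain ⟨q, rfl⟩ : ∃ q, M = q + 2 := ⟨M - 2, by omega⟩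
  set e := chartAt (Euc (q + 2)) Q
  have hQe : Q ∈ e.source := mem_chart_source _ Q
  have hP : e.symm (e Q) = Q := e.left_inv hQe
  have heq := inChart_structure_equation hι hφ hδφ hded hU hf hQU hQ
    (IsManifold.chart_mem_maximalAtlas Q) (IsManifold.chart_mem_maximalAtlas Q) hQe
  -- Every pair of tangent vectors comes from vectors `a`, `b` in the chart, so the chart identity
  -- determines the forms at `Q`.
  have hsurj : Function.Surjective
      (mfderiv 𝓘(ℝ, Euc (q + 2)) 𝓘(ℝ, Euc (q + 2)) e.symm (e Q)) :=
    (mdifferentiable_of_mem_atlas (chart_mem_atlas _ Q)).symm.mfderiv_surjective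
      (e.map_source hQe)
  -- The tangent space depends on the base point, so the equation is proved at `e.symm (e Q)`, where
  -- the chart forms live, and moved to `Q` as a whole.
  suffices H : δφ (e.symm (e Q)) = -matWedge (φ (e.symm (e Q))) (φ (e.symm (e Q))) by
    rwa [hP] at H
  funext i j
  refine ContinuousAlternatingMap.ext fun v => ?_
  obtain ⟨a, ha⟩ := hsurj (v 0)
  obtain ⟨b, hb⟩ := hsurj (v 1)
  have h2 := heq i j a b
  have hone : ∀ k l c w, mfderiv 𝓘(ℝ, Euc (q + 2)) 𝓘(ℝ, Euc (q + 2)) e.symm (e Q) c = w →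
      MatForm.inChart e φ (e Q) k l ![c] = φ (e.symm (e Q)) k l ![w] := by
    rintro k l c w rfl
    change φ (e.symm (e Q)) k l _ = _
    congr 1
    funext s
    fin_cases s
    rfl
  have hv : v = ![v 0, v 1] := by
    funext s
    fin_cases s <;> rfl
  have htwo : MatForm.inChart e δφ (e Q) i j ![a, b] = δφ (e.symm (e Q)) i j v := by
    rw [hv, ← ha, ← hb]
    change δφ (e.symm (e Q)) i j _ = _
    congr 1
    funext s
    fin_cases s <;> rfl
  refine (htwo.symm.trans h2).trans ?_
  change _ = -((∑ k, wedge (φ (e.symm (e Q)) i k) (φ (e.symm (e Q)) k j)) v)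
  rw [hv]
  erw [ContinuousAlternatingMap.sum_apply]
  refine congrArg Neg.neg (Finset.sum_congr rfl fun k _ => ?_)
  exact (congrArg₂ (· - ·)
    (congrArg₂ (· * ·) (hone i k a _ ha) (hone k j b _ hb))
    (congrArg₂ (· * ·) (hone i k b _ hb) (hone k j a _ ha))).trans
    (wedge_one_one_apply _ _ _ _).symm
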